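/- For an integer $n\ge 3$ and a real number $h>0$ let $P_n(h)\subset\mathbb{R}^3$ be the right pyramid of height $h$ over the regular $n$-gon whose vertices are the $n$-th roots of unity $\mu_n\subset\mathbb{C}=\mathbb{R}^2$, i.e. the convex hull of $\{(\operatorname{Re}z,\operatorname{Im}z,0) : z^n=1\}$ and the apex $(0,0,h)$. For a convex polytope $P\subset\mathbb{R}^3$ with nonempty interior let $$\operatorname{Dehn}(P)=\sum_{e}\ell(e)\otimes\theta(e)\in\mathbb{R}\otimes_{\mathbb{Z}}\mathbb{R}/\pi\mathbb{Z}$$ be its Dehn invariant, where $e$ runs over the edges of $P$, $\ell(e)$ is the length of $e$ and $\theta(e)$ is the interior dihedral angle of $P$ along $e$. Call $P$ rational if all its dihedral angles are rational multiples of $\pi$. **Theorem 1.** For every $h>0$: 1. $\operatorname{Dehn}(P_4(h))=0$ if and only if $h=1/\sqrt2$. 2. $P_4(h)$ is rational if and only if $h=1/\sqrt2$. 3. $\operatorname{Dehn}(P_3(h))\neq0$ and $\operatorname{Dehn}(P_6(h))\neq0$. Moreover, $P_4(1/\sqrt2)$ is the pyramid that cuts a cube into six: there is a cube which is the union of six isometric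 copies of $P_4(1/\sqrt2)$ with pairwise disjoint interiors. -/

import Mathlib

open scoped TensorProduct

/-- Three-dimensional Euclidean space. -/
abbrev E3 : Type := EuclideanSpace ℝ (Fin 3)

/-- The faces of dimension `k` of a convex polytope `P`: the nonempty subsets of `P` on which
some linear functional attains its maximum over `P`, and whose affine span has dimension `k`. -/
def faces (P : Set E3) (k : ℕ) : Set (Set E3) :=
  {F | F.Nonempty ∧ IsExposed ℝ P F ∧ Module.finrank ℝ (vectorSpan ℝ F) = k}

/-- The edges of `P`. Each one is a segment, whose length is its diameter. -/
def edges (P : Set E3) : Set (Set E3) := faces P 1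

/-- The facets (two-dimensional faces) of `P`. -/
def facets (P : Set E3) : Set (Set E3) := faces P 2

/-- `α` is the angle, measured in a plane perpendicular to `e`, between the two facets `F`, `G`
of `P` that meet along `e`: the angle at a point `m` of `e` between a point `p` of `F` and a point
`q` of `G` such that `p - m` and `q - m` are nonzero and perpendicular to `e`. -/
def IsDihedralAngle (P e : Set E3) (α : ℝ) : Prop :=
  ∃ F ∈ facets P, ∃ G ∈ facets P, F ∩ G = e ∧
    ∃ m ∈ e, ∃ p ∈ F, ∃ q ∈ G, p ≠ m ∧ q ≠ m ∧
      (∀ x ∈ e, inner ℝ (p - m) (x - m) = 0) ∧ (∀ x ∈ e, inner ℝ (q - m) (x - m) = 0) ∧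
      α = EuclideanGeometry.angle p m q

/-- The interior dihedral angle of a convex polytope `P` with nonempty interior along its edge `e`:
the unique `α` with `IsDihedralAngle P e α`. -/
noncomputable def dihedralAngle (P e : Set E3) : ℝ := sSup {α | IsDihedralAngle P e α}

/-- The Dehn invariant of a convex polytope with nonempty interior, in `ℝ ⊗_ℤ ℝ/πℤ`: the sum over
all edges of the tensors `length ⊗ dihedral angle`. -/
noncomputable def dehnInvariant (P : Set E3) : ℝ ⊗[ℤ] AddCircle Real.pi :=
  ∑ᶠ e ∈ edges P, Metric.diam e ⊗ₜ[ℤ] ((dihedralAngle P e : ℝ) : AddCircle Real.pi)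

/-- A polytope is rational if all its dihedral angles are rational multiples of `π`. -/
def IsRationalPolytope (P : Set E3) : Prop :=
  ∀ e ∈ edges P, ∃ r : ℚ, dihedralAngle P e = r * Real.pi

/-- The right pyramid of height `h` over the regular polygon whose vertices are the `n`-th roots of
unity: the convex hull of these points of the horizontal plane and of the apex `(0, 0, h)`. -/
def pyramid (n : ℕ) (h : ℝ) : Set E3 :=
  convexHull ℝ (insert !₂[0, 0, h] ((fun z : ℂ => !₂[z.re, z.im, 0]) '' {z : ℂ | z ^ n = 1}))

/-- A (solid) cube: an isometric image of `[-s, s]³` for some `s > 0`. -/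
def IsCube (C : Set E3) : Prop :=
  ∃ s : ℝ, 0 < s ∧ ∃ g : E3 ≃ᵢ E3, C = g '' {x | ∀ i, |x i| ≤ s}

/-- `C` is cut into six isometric copies of `P`, with pairwise disjoint interiors. -/
def IsCutIntoSix (C P : Set E3) : Prop :=
  ∃ g : Fin 6 → (E3 ≃ᵢ E3), C = ⋃ i, g i '' P ∧
    Pairwise fun i j => Disjoint (interior (g i '' P)) (interior (g j '' P))

/-! By symmetry a pyramid has only two kinds of edges: the base edges, of length `l₁ = √(2 - 2c)`
and dihedral angle `a`, and the lateral edges, of length `l₂ = √(1 + h²)` and dihedral angle `b`,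
where `c = cos (2π/n)`. The Dehn invariant is therefore a positive multiple of `l₁ ⊗ a + l₂ ⊗ b`
(`RegularPolygon.dehnInvariant_eq`). Applying `ℚ`-linear functionals to the lengths shows that if it
vanishes, then either `a` and `b` are both rational multiples of `π`, or `q l₂ = p l₁` with `p`, `q`
coprime and positive and `q a + p b` is a rational multiple of `π`
(`rational_or_dependent_of_tmul_add_tmul_eq_zero`).

Rational case. For `c = 0, ±1/2` a linear relation between `cos 2a` and `cos b` makes `cos 2a` an
algebraic integer. Its conjugates have absolute value at most 1, so by Kronecker's theorem and `0 <
2a < π` it vanishes (`cos_eq_zero_of_isIntegral`). For the square this forces `h² = 1/2`; otherwise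
`cos b` is a rational number excluded by Niven's theorem.

Dependent case. With a suitable `y > 0` whose square is rational, `e^{2ia} = (q + iy)/(q - iy)` and
`e^{ib} = (iy - 2p)/(iy + 2p)`. A rational combination of the angles becomes a multiplicative
relation between elements of an imaginary quadratic field. Modulo a prime ideal above a prime factor
of `q + 2p`, one side vanishes and the other does not (`quadratic_reduction`). This leaves so few
prime powers in `q + 2p` that `q < 2p` excludes everything for `c = 0, -1/2`. For `c = 1/2` there
remains `(p, q) = (5, 2)`, where `cos 6a = cos (π - b)`; then `2a` would be a rational multiple of
`π` with cosine `-3/4`.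

The geometric input is the face lattice: faces of a convex hull correspond to the sets of generators
at which a functional is maximal (`mem_faces_convexHull_iff`), and these are listed for a pyramid in
`RegularPolygon.isArgmax_cases`. The cube is cut by coning its six facets from its centre. -/

/-! ### Tensors with angles and rational multiples of `π`. -/

/-- The real numbers that are rational multiples of `π`. -/
noncomputable abbrev ratPi : Submodule ℚ ℝ := Submodule.span ℚ {Real.pi}

theorem mem_ratPi {x : ℝ} : x ∈ ratPi ↔ ∃ r : ℚ, x = r * Real.pi := by
  rw [Submodule.mem_span_singleton]
  simp only [Rat.smul_def, eq_comm]

theorem pi_mem_ratPi : Real.pi ∈ ratPi := Submodule.mem_span_singleton_self _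

theorem mem_ratPi_of_int_mul {x : ℝ} {k : ℤ} (hk : k ≠ 0) (h : k * x ∈ ratPi) : x ∈ ratPi := by
  have := ratPi.smul_mem (k : ℚ)⁻¹ h
  rwa [Rat.smul_def, Rat.cast_inv, Rat.cast_intCast, inv_mul_cancel_left₀] at this
  exact_mod_cast hk

theorem int_mul_mem_ratPi {x : ℝ} (k : ℤ) (h : x ∈ ratPi) : k * x ∈ ratPi := by
  simpa [Rat.smul_def] using ratPi.smul_mem (k : ℚ) h

/-- Lengths are divisible: the denominator of `x/π` can be split off from `l` and moved across the
tensor sign, where it kills `x` modulo `π`. -/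
theorem tmul_eq_zero_of_mem_ratPi (l : ℝ) {x : ℝ} (hx : x ∈ ratPi) :
    l ⊗ₜ[ℤ] ((x : ℝ) : AddCircle Real.pi) = 0 := by
  obtain ⟨r, rfl⟩ := mem_ratPi.1 hx
  have hd : (r.den : ℝ) ≠ 0 := by exact_mod_cast r.den_ne_zero
  have h1 : l = (r.den : ℤ) • (l / r.den) := by
    simp only [zsmul_eq_mul, Int.cast_natCast]; field_simp
  have h2 : (r.den : ℤ) • (((r * Real.pi : ℝ)) : AddCircle Real.pi) = 0 := by
    rw [← AddCircle.coe_zsmul, AddCircle.coe_eq_zero_iff]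
    refine ⟨r.num, ?_⟩
    simp only [zsmul_eq_mul, Int.cast_natCast]
    have : (r : ℝ) = r.num / r.den := by exact_mod_cast (Rat.num_div_den r).symm
    rw [this]; field_simp
  rw [h1, TensorProduct.smul_tmul, h2, TensorProduct.tmul_zero]

/-- A `ℚ`-linear functional on lengths turns tensors into angles modulo `πℚ`. -/
noncomputable def angleOfFunctional (f : ℝ →ₗ[ℚ] ℚ) :
    ℝ ⊗[ℤ] AddCircle Real.pi →+ ℝ ⧸ ratPi :=
  TensorProduct.liftAddHom
    (((LinearMap.toAddMonoidHom'.comp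
      (LinearMap.lsmul ℚ (ℝ ⧸ ratPi)).toAddMonoidHom).comp f.toAddMonoidHom).compl₂
        (QuotientAddGroup.lift _ (ratPi.mkQ).toAddMonoidHom (by
          rintro x hx
          obtain ⟨k, rfl⟩ := AddSubgroup.mem_zmultiples_iff.1 hx
          simpa using (Submodule.Quotient.mk_eq_zero ratPi).2 (zsmul_mem pi_mem_ratPi k))))
    (by
      intro k x y
      simp only [AddMonoidHom.compl₂_apply, AddMonoidHom.coe_comp, Function.comp_apply, map_zsmul]
      rfl)

theorem angleOfFunctional_tmul (f : ℝ →ₗ[ℚ] ℚ) (l x : ℝ) :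
    angleOfFunctional f (l ⊗ₜ[ℤ] ((x : ℝ) : AddCircle Real.pi)) = ratPi.mkQ (f l * x) := by
  rw [← Rat.smul_def, map_smul]; rfl

theorem functional_mem_ratPi {l₁ l₂ x y : ℝ} {n : ℕ} (hn : n ≠ 0)
    (h : n • (l₁ ⊗ₜ[ℤ] ((x : ℝ) : AddCircle Real.pi) + l₂ ⊗ₜ[ℤ] ((y : ℝ) : AddCircle Real.pi)) = 0)
    (f : ℝ →ₗ[ℚ] ℚ) : f l₁ * x + f l₂ * y ∈ ratPi := by
  have := congrArg (angleOfFunctional f) h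
  rw [map_nsmul, map_add, angleOfFunctional_tmul, angleOfFunctional_tmul, ← map_add, ← map_nsmul,
    map_zero, Submodule.mkQ_apply, Submodule.Quotient.mk_eq_zero] at this
  apply mem_ratPi_of_int_mul (k := n) (by exact_mod_cast hn)
  simpa [mul_add] using this

/-- If the lengths are independent over `ℚ`, a functional can kill either one and not the other,
which isolates each angle. If they are proportional, one functional that is nonzero on `l₁` gives
the only relation. -/
theorem rational_or_dependent_of_tmul_add_tmul_eq_zero {l₁ l₂ x y : ℝ} {n : ℕ} (hn : n ≠ 0)
    (h₁ : 0 < l₁) (h₂ : 0 < l₂)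
    (h : n • (l₁ ⊗ₜ[ℤ] ((x : ℝ) : AddCircle Real.pi) + l₂ ⊗ₜ[ℤ] ((y : ℝ) : AddCircle Real.pi)) = 0) :
    (x ∈ ratPi ∧ y ∈ ratPi) ∨
      ∃ p q : ℕ, 0 < p ∧ 0 < q ∧ p.Coprime q ∧ q * l₂ = p * l₁ ∧ (q * x + p * y : ℝ) ∈ ratPi := by
  have key : ∀ {u v s t : ℝ}, (∀ f : ℝ →ₗ[ℚ] ℚ, f u * s + f v * t ∈ ratPi) →
      v ∉ Submodule.span ℚ {u} → t ∈ ratPi := by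
    intro u v s t H hv
    obtain ⟨f, hf, hf'⟩ := Submodule.exists_le_ker_of_notMem hv
    have hu : f u = 0 := hf' (Submodule.mem_span_singleton_self u)
    have := ratPi.smul_mem (f v)⁻¹ (H f)
    rw [hu, Rat.cast_zero, zero_mul, zero_add, ← Rat.smul_def, smul_smul, inv_mul_cancel₀ hf,
      one_smul] at this
    exact this
  have H := functional_mem_ratPi hn h
  by_cases hd : l₂ ∈ Submodule.span ℚ {l₁}
  · right
    obtain ⟨ρ, rfl⟩ := Submodule.mem_span_singleton.1 hd
    rw [Rat.smul_def] at h₂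
    have hρ : 0 < ρ := by
      have := (pos_iff_pos_of_mul_pos h₂).2 h₁
      exact_mod_cast this
    have h0 : l₁ ∉ (⊥ : Submodule ℚ ℝ) := by simpa using h₁.ne'
    obtain ⟨f, hf, -⟩ := Submodule.exists_le_ker_of_notMem h0
    have hnum : (ρ.num.toNat : ℤ) = ρ.num := Int.toNat_of_nonneg (Rat.num_pos.2 hρ).le
    have hnum' : ((ρ.num.toNat : ℕ) : ℝ) = ρ.num := by exact_mod_cast hnum
    have hd : (ρ.den : ℝ) ≠ 0 := by exact_mod_cast ρ.den_ne_zero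
    have hρ' : (ρ : ℝ) = ρ.num / ρ.den := by exact_mod_cast (Rat.num_div_den ρ).symm
    refine ⟨ρ.num.toNat, ρ.den, ?_, ρ.den_pos, ?_, ?_, ?_⟩
    · have := Rat.num_pos.2 hρ
      omega
    · have := ρ.reduced
      rwa [← hnum, Int.natAbs_natCast] at this
    · rw [Rat.smul_def, hnum', hρ']; field_simp
    · have := ratPi.smul_mem ((ρ.den : ℚ) * (f l₁)⁻¹) (H f)
      rw [map_smul, Rat.smul_def, smul_eq_mul] at this
      push_cast at this
      rw [hnum']
      convert this using 1
      have hf' : (f l₁ : ℝ) ≠ 0 := by exact_mod_cast hf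
      rw [hρ']
      field_simp
  · left
    refine ⟨key (u := l₂) (s := y) (fun f => by rw [add_comm]; exact H f) ?_, key H hd⟩
    intro hd'
    obtain ⟨ρ, rfl⟩ := Submodule.mem_span_singleton.1 hd'
    rw [Rat.smul_def] at h₁
    have hρ : ρ ≠ 0 := by rintro rfl; simp at h₁
    exact hd (Submodule.mem_span_singleton.2 ⟨ρ⁻¹, by rw [smul_smul, inv_mul_cancel₀ hρ, one_smul]⟩)

/-! ### Cosines of rational angles that are algebraic integers. -/

/-- Kronecker's theorem: every conjugate of `(ζ + ζ⁻¹)/2`, for a root of unity `ζ`, has absolute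
value at most 1, so a nonzero algebraic integer of this form is a root of unity, and a real one is
`±1`. -/
theorem cos_eq_of_isIntegral {x : ℝ} (hx : x ∈ ratPi) (hi : IsIntegral ℤ (Real.cos x)) :
    Real.cos x = 0 ∨ Real.cos x = 1 ∨ Real.cos x = -1 := by
  obtain ⟨r, rfl⟩ := mem_ratPi.1 hx
  by_cases h0 : Real.cos (r * Real.pi) = 0
  · exact .inl h0
  right
  set z : ℂ := Complex.exp (r * Real.pi * Complex.I) with hz
  have hz1 : z ^ (2 * r.den) = 1 := Complex.exp_rat_mul_pi_mul_I_pow_two_mul_den r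
  have hzi : IsIntegral ℚ z := (Complex.isIntegral_exp_rat_mul_pi_mul_I r).tower_top
  let K := IntermediateField.adjoin ℚ {z}
  have : FiniteDimensional ℚ K := IntermediateField.adjoin.finiteDimensional hzi
  have : NumberField K := ⟨⟩
  let ζ : K := ⟨z, IntermediateField.mem_adjoin_simple_self ℚ z⟩
  have hζ : ζ ^ (2 * r.den) = 1 := Subtype.ext hz1
  have hd : 2 * r.den ≠ 0 := by have := r.den_pos; omega
  let u : K := (ζ + ζ⁻¹) / 2
  have hu : (u : ℂ) = Real.cos (r * Real.pi) := by
    have : (u : ℂ) = (z + z⁻¹) / 2 := by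
      simp only [u, ζ, IntermediateField.coe_div, IntermediateField.coe_add, IntermediateField.coe_inv]
      rfl
    rw [this, hz, ← Complex.exp_neg, Complex.ofReal_cos, Complex.cos]
    push_cast
    ring_nf
  have hui : IsIntegral ℤ u := by
    have h1 : IsIntegral ℤ ((u : K) : ℂ) := by
      rw [hu]; exact (isIntegral_algebraMap_iff (B := ℂ) (A := ℝ) RCLike.ofReal_injective).2 hi
    exact (isIntegral_algebraMap_iff (A := K) (B := ℂ) (algebraMap K ℂ).injective).1 h1
  have hu0 : u ≠ 0 := by
    rintro h
    rw [h] at hu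
    exact h0 (Complex.ofReal_eq_zero.1 hu.symm)
  obtain ⟨n, hn, hun⟩ := NumberField.Embeddings.pow_eq_one_of_norm_le_one K ℂ hu0 hui (by
    intro φ
    have h1 : ‖φ ζ‖ = 1 := by
      apply Complex.norm_eq_one_of_pow_eq_one (n := 2 * r.den) _ hd
      rw [← map_pow, hζ, map_one]
    have h2 : ‖(φ ζ)⁻¹‖ = 1 := by rw [norm_inv, h1, inv_one]
    calc ‖φ u‖ = ‖(φ ζ + (φ ζ)⁻¹) / 2‖ := by simp only [u, map_div₀, map_add, map_inv₀, map_ofNat]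
      _ = ‖φ ζ + (φ ζ)⁻¹‖ / 2 := by rw [norm_div, Complex.norm_ofNat]
      _ ≤ (‖φ ζ‖ + ‖(φ ζ)⁻¹‖) / 2 := by gcongr; exact norm_add_le _ _
      _ = 1 := by rw [h1, h2]; norm_num)
  have h3 : Real.cos (r * Real.pi) ^ n = 1 := by
    have := congrArg (fun t : K => (t : ℂ)) hun
    simp only [IntermediateField.coe_pow, hu] at this
    rw [← Complex.ofReal_pow] at this
    exact Complex.ofReal_injective this
  have h4 : |Real.cos (r * Real.pi)| = 1 := by
    rw [← pow_eq_one_iff_of_nonneg (abs_nonneg _) hn.ne', ← abs_pow, h3, abs_one]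
  exact (abs_eq one_pos.le).1 h4

/-- If `x` is a rational multiple of `π` strictly between `0` and `π` whose cosine is an algebraic
integer, then this cosine vanishes. -/
theorem cos_eq_zero_of_isIntegral {x : ℝ} (hx : x ∈ ratPi) (h0 : 0 < x) (hpi : x < Real.pi)
    (hi : IsIntegral ℤ (Real.cos x)) : Real.cos x = 0 := by
  have h1 : Real.cos x < 1 := by
    simpa using Real.cos_lt_cos_of_nonneg_of_le_pi le_rfl hpi.le h0
  have h2 : -1 < Real.cos x := by
    simpa using Real.cos_lt_cos_of_nonneg_of_le_pi h0.le le_rfl hpi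
  rcases cos_eq_of_isIntegral hx hi with h | h | h
  · exact h
  · linarith
  · linarith

theorem isIntegral_two_mul_cos {x : ℝ} (hx : x ∈ ratPi) : IsIntegral ℤ (2 * Real.cos x) := by
  obtain ⟨r, rfl⟩ := mem_ratPi.1 hx
  exact Real.isIntegral_two_mul_cos_rat_mul_pi r

/-! ### Multiplicative relations in imaginary quadratic orders. -/

/-- Since `w` is not real, the order `ℤ[w]` embeds into `ℂ`, so a relation between complex numbers
lifts to the order. It can then be pushed to `ZMod r` along `w ↦ t`, a root of the same quadratic
polynomial. A vanishing factor on the left forces one on the right. -/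
theorem quadratic_reduction {a b : ℤ} {w : ℂ} (hw : w.im ≠ 0) (hw2 : w * w = a + b * w)
    {r : ℕ} [Fact r.Prime] {t : ZMod r} (ht : t * t = a + b * t)
    {X₁ X₂ Y₁ Y₂ : ℤ × ℤ} {A B : ℕ} (hA : A ≠ 0)
    (h : (X₁.1 + X₁.2 * w) ^ A * (X₂.1 + X₂.2 * w) ^ B =
      (Y₁.1 + Y₁.2 * w) ^ A * (Y₂.1 + Y₂.2 * w) ^ B)
    (hX : (X₁.1 + X₁.2 * t : ZMod r) = 0) :
    (Y₁.1 + Y₁.2 * t : ZMod r) = 0 ∨ (Y₂.1 + Y₂.2 * t : ZMod r) = 0 := by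
  let φ : QuadraticAlgebra ℤ a b →ₐ[ℤ] ℂ :=
    QuadraticAlgebra.lift ⟨w, by rw [hw2]; simp [zsmul_eq_mul]⟩
  let ψ : QuadraticAlgebra ℤ a b →ₐ[ℤ] ZMod r :=
    QuadraticAlgebra.lift ⟨t, by rw [ht]; simp [zsmul_eq_mul]⟩
  have hφ : ∀ x y : ℤ, φ ⟨x, y⟩ = x + y * w := by
    intro x y; simp [φ, QuadraticAlgebra.lift]
  have hψ : ∀ x y : ℤ, ψ ⟨x, y⟩ = x + y * t := by
    intro x y; simp [ψ, QuadraticAlgebra.lift]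
  have hinj : Function.Injective φ := by
    rw [injective_iff_map_eq_zero]
    rintro ⟨x, y⟩ hxy
    rw [hφ] at hxy
    have him := congrArg Complex.im hxy
    have hre := congrArg Complex.re hxy
    simp only [Complex.add_im, Complex.mul_im, Complex.intCast_im, Complex.intCast_re,
      Complex.add_re, Complex.mul_re, Complex.zero_im, Complex.zero_re] at him hre
    have hy : (y : ℝ) = 0 := by
      have : (y : ℝ) * w.im = 0 := by linarith
      exact (mul_eq_zero.1 this).resolve_right hw
    have hx : (x : ℝ) = 0 := by rw [hy] at hre; linarith
    ext
    · exact_mod_cast hx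
    · exact_mod_cast hy
  rw [← hφ, ← hφ, ← hφ, ← hφ, ← map_pow, ← map_pow, ← map_pow, ← map_pow, ← map_mul, ← map_mul] at h
  have h2 := congrArg ψ (hinj h)
  rw [map_mul, map_mul, map_pow, map_pow, map_pow, map_pow, hψ, hψ, hψ, hψ, hX, zero_pow hA,
    zero_mul] at h2
  rcases mul_eq_zero.1 h2.symm with h3 | h3
  · exact .inl (eq_zero_of_pow_eq_zero h3)
  · exact .inr (eq_zero_of_pow_eq_zero h3)

/-- The multiplicative relation between the numbers `X ± iY`, `iY ± Z` which expresses that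
`A` times twice the argument of `X + iY` and `B` times twice the argument of `Y + iZ` add up to a
multiple of `2π`. -/
def RootRelation (A B : ℕ) (X Z Y : ℝ) : Prop :=
  ((X : ℂ) + Y * Complex.I) ^ A * (Y * Complex.I - Z) ^ B =
    (X - Y * Complex.I) ^ A * (Y * Complex.I + Z) ^ B

theorem RootRelation.scale {A B : ℕ} {X Z Y : ℝ} (h : RootRelation A B X Z Y) (c : ℝ) :
    RootRelation A B (c * X) (c * Z) (c * Y) := by
  unfold RootRelation at *
  push_cast
  have e1 : (c * X + c * Y * Complex.I : ℂ) = c * (X + Y * Complex.I) := by ring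
  have e2 : (c * Y * Complex.I - c * Z : ℂ) = c * (Y * Complex.I - Z) := by ring
  have e3 : (c * X - c * Y * Complex.I : ℂ) = c * (X - Y * Complex.I) := by ring
  have e4 : (c * Y * Complex.I + c * Z : ℂ) = c * (Y * Complex.I + Z) := by ring
  rw [e1, e2, e3, e4, mul_pow, mul_pow, mul_pow, mul_pow, mul_mul_mul_comm, h, mul_mul_mul_comm]

/-- The half-angle formula: `φ/2` is the argument of `x + iy`. The range of `φ` fixes the sign of
the sine. -/
theorem exp_mul_of_cos_eq {φ x y : ℝ} (h0 : 0 ≤ φ) (hpi : φ ≤ Real.pi) (hx : 0 < x) (hy : 0 < y)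
    (hc : Real.cos φ = (x ^ 2 - y ^ 2) / (x ^ 2 + y ^ 2)) :
    Complex.exp (φ * Complex.I) * (x - y * Complex.I) = x + y * Complex.I := by
  have hs : Real.sin φ = 2 * x * y / (x ^ 2 + y ^ 2) := by
    rw [Real.sin_eq_sqrt_one_sub_cos_sq h0 hpi, hc, Real.sqrt_eq_iff_mul_self_eq (by
      rw [sub_nonneg, sq_le_one_iff_abs_le_one, ← hc]; exact Real.abs_cos_le_one _) (by positivity)]
    field_simp; ring
  rw [Complex.exp_mul_I, ← Complex.ofReal_cos, ← Complex.ofReal_sin, hs, hc]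
  apply Complex.ext
  · simp [-Complex.ofReal_div, -Complex.ofReal_cos, -Complex.ofReal_sin]; field_simp; ring
  · simp [-Complex.ofReal_div, -Complex.ofReal_cos, -Complex.ofReal_sin]; field_simp; ring

theorem exists_rootRelation {α β X Y Z : ℝ} {A B : ℕ} (hα : 0 ≤ α) (hα' : α ≤ Real.pi) (hβ : 0 ≤ β)
    (hβ' : β ≤ Real.pi) (hX : 0 < X) (hY : 0 < Y) (hZ : 0 < Z)
    (hca : Real.cos α = (X ^ 2 - Y ^ 2) / (X ^ 2 + Y ^ 2))
    (hcb : Real.cos β = (Y ^ 2 - Z ^ 2) / (Y ^ 2 + Z ^ 2)) (h : (A * α + B * β : ℝ) ∈ ratPi) :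
    ∃ N : ℕ, N ≠ 0 ∧ RootRelation (A * N) (B * N) X Z Y := by
  obtain ⟨r, hr⟩ := mem_ratPi.1 h
  -- The factor 2 is needed because `exp (i r π)` to the power `r.den` may be `-1`.
  refine ⟨2 * r.den, by have := r.den_pos; omega, ?_⟩
  have ha := exp_mul_of_cos_eq hα hα' hX hY hca
  have hb : Complex.exp (β * Complex.I) * (Y * Complex.I + Z) = Y * Complex.I - Z := by
    have := congrArg (· * Complex.I) (exp_mul_of_cos_eq hβ hβ' hY hZ hcb)
    beta_reduce at this
    linear_combination this + (1 + Complex.exp (β * Complex.I)) * Z * Complex.I_sq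
  have he : Complex.exp (α * Complex.I) ^ (A * (2 * r.den)) *
      Complex.exp (β * Complex.I) ^ (B * (2 * r.den)) = 1 := by
    rw [pow_mul, pow_mul _ B, ← mul_pow, ← Complex.exp_nat_mul, ← Complex.exp_nat_mul, ← Complex.exp_add,
      ← Complex.exp_rat_mul_pi_mul_I_pow_two_mul_den r]
    congr 2
    have : (A * α + B * β : ℂ) = r * Real.pi := by exact_mod_cast congrArg (fun t : ℝ => (t : ℂ)) hr
    rw [← this]; ring
  unfold RootRelation
  rw [← ha, ← hb, mul_pow, mul_pow, mul_mul_mul_comm, he, one_mul]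

/-- Modulo `r`, `(iY)² = X² + e` becomes `X²`, so `iY ↦ -X` is a reduction. It sends `X + iY` to 0,
but `X - iY` to `2X` and `iY + Z` to `-2X`, which are nonzero. -/
theorem not_rootRelation_of_odd_prime {A B : ℕ} (hA : A ≠ 0) {X Z e : ℤ} {Y : ℝ} (hY : 0 < Y)
    (hY2 : Y ^ 2 = -(X ^ 2 + e)) {r : ℕ} (hr : r.Prime) (hr2 : r ≠ 2) (he : (r : ℤ) ∣ e)
    (hXZ : (r : ℤ) ∣ X + Z) (hX : ¬ (r : ℤ) ∣ X) : ¬ RootRelation A B X Z Y := by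
  intro h
  have : Fact r.Prime := ⟨hr⟩
  have hw : ((Y : ℂ) * Complex.I).im ≠ 0 := by simpa using hY.ne'
  have he' : ((e : ℤ) : ZMod r) = 0 := (ZMod.intCast_zmod_eq_zero_iff_dvd _ _).2 he
  have hX' : ((X : ℤ) : ZMod r) ≠ 0 := fun h => hX ((ZMod.intCast_zmod_eq_zero_iff_dvd _ _).1 h)
  have hZ' : ((X : ℤ) : ZMod r) + Z = 0 := by
    exact_mod_cast (ZMod.intCast_zmod_eq_zero_iff_dvd _ _).2 hXZ
  have h2 : (2 : ZMod r) ≠ 0 := by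
    intro h
    have : ((2 : ℕ) : ZMod r) = 0 := by exact_mod_cast h
    rw [ZMod.natCast_eq_zero_iff] at this
    exact hr2 ((Nat.prime_dvd_prime_iff_eq hr Nat.prime_two).1 this)
  have hY2' : (Y : ℂ) ^ 2 = -(X ^ 2 + e) := by exact_mod_cast congrArg (fun t : ℝ => (t : ℂ)) hY2
  have key := quadratic_reduction (a := X ^ 2 + e) (b := 0) (w := Y * Complex.I) hw (by
      push_cast
      linear_combination (Y : ℂ) ^ 2 * Complex.I_sq - hY2')
    (r := r) (t := -X) (by push_cast; rw [he']; ring)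
    (X₁ := (X, 1)) (X₂ := (-Z, 1)) (Y₁ := (X, -1)) (Y₂ := (Z, 1)) (A := A) (B := B) hA (by
      unfold RootRelation at h
      push_cast at h ⊢
      convert h using 3 <;> ring) (by push_cast; ring)
  push_cast at key
  rcases key with k | k
  · exact mul_ne_zero h2 hX' (by linear_combination k)
  · exact mul_ne_zero h2 hX' (by linear_combination hZ' - k)

/-- The analogue at the prime 2. As `(iY)² ≡ 1` modulo 8, the prime 2 splits in the larger order
generated by `w = (1 + iY)/2`, where `w² ≡ w` modulo 2. The four numbers of the relation are halved
so as to be read there. -/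
theorem not_rootRelation_of_four_dvd {A B : ℕ} (hA : A ≠ 0) {s p e : ℤ} {Y : ℝ} (hY : 0 < Y)
    (hY2 : Y ^ 2 = -(s ^ 2 + e)) (he : 8 ∣ e) (hs : Odd s) (hsp : 4 ∣ s + p) :
    ¬ RootRelation A B s p Y := by
  intro h
  obtain ⟨m, rfl⟩ := hs
  obtain ⟨k, hk⟩ := hsp
  obtain ⟨f, rfl⟩ := he
  obtain rfl : p = 4 * k - 2 * m - 1 := by linarith
  have h := h.scale (1 / 2)
  unfold RootRelation at h
  push_cast at h hY2
  have hY2' : (Y : ℂ) ^ 2 = -((2 * m + 1) ^ 2 + 8 * f) := by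
    have := congrArg (fun t : ℝ => (t : ℂ)) hY2
    push_cast at this
    exact this
  have hw : ((1 + (Y : ℂ) * Complex.I) / 2).im ≠ 0 := by simpa using hY.ne'
  have h2 : (2 : ZMod 2) = 0 := rfl
  have key := quadratic_reduction (a := m ^ 2 + m + 2 * f) (b := 1)
    (w := (1 + (Y : ℂ) * Complex.I) / 2) hw (by
      push_cast
      linear_combination (Y : ℂ) ^ 2 / 4 * Complex.I_sq - hY2' / 4)
    (r := 2) (t := m) (by push_cast; linear_combination (-m - f) * h2)
    (X₁ := (m, 1)) (X₂ := (-(2 * k - m), 1)) (Y₁ := (m + 1, -1)) (Y₂ := (2 * k - m - 1, 1))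
    (A := A) (B := B) hA (by
      push_cast at h ⊢
      convert h using 3 <;> ring) (by push_cast; linear_combination m * h2)
  push_cast at key
  rcases key with k' | k'
  · exact one_ne_zero (by linear_combination k' : (1 : ZMod 2) = 0)
  · exact one_ne_zero (by linear_combination -k' + k * h2 : (1 : ZMod 2) = 0)

theorem not_dvd_of_coprime {p q r : ℕ} (hpq : p.Coprime q) (hr : r.Prime) (hr2 : r ≠ 2)
    (h : (r : ℤ) ∣ q + 2 * p) : ¬ (r : ℤ) ∣ q := by
  intro hq
  have h1 : (r : ℤ) ∣ 2 * p := (dvd_add_right hq).1 h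
  have h1' : r ∣ 2 * p := by exact_mod_cast h1
  have h2 : r ∣ q := by exact_mod_cast hq
  rcases hr.dvd_mul.1 h1' with h3 | h3
  · exact hr2 ((Nat.prime_dvd_prime_iff_eq hr Nat.prime_two).1 h3)
  · exact hr.one_lt.ne' (Nat.dvd_one.1 (hpq ▸ Nat.dvd_gcd h3 h2))

theorem eq_one_of_forall_prime_eq_two {m : ℕ} (hm : Odd m) (h : ∀ r : ℕ, r.Prime → r ∣ m → r = 2) :
    m = 1 := by
  by_contra h1
  obtain ⟨r, hr, hrm⟩ := Nat.exists_prime_and_dvd h1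
  obtain rfl := h r hr hrm
  obtain ⟨k, rfl⟩ := hm
  omega

theorem eight_dvd_sq_sub_sq {s p : ℤ} (hs : Odd s) (hp : Odd p) : 8 ∣ s ^ 2 - p ^ 2 := by
  have a := Int.eight_dvd_sq_sub_one_of_odd hs
  have b := Int.eight_dvd_sq_sub_one_of_odd hp
  have := dvd_sub a b
  rwa [sub_sub_sub_cancel_right] at this

/-- Odd primes dividing `q + 2p` are excluded by reduction. If `q` is odd, `q + 2p = 1` is too
small. If `q = 2s`, the prime 2 is handled by halving: `4 ∣ s + p` is excluded too, and `s + p` at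
most 2 contradicts `s < p`. -/
theorem not_rootRelation_of_sq_eq {A B : ℕ} (hA : A ≠ 0) {p q : ℕ} (hq : 0 < q)
    (hpq : p.Coprime q) {k : ℕ} {y : ℝ} (hy : 0 < y)
    (hy2 : y ^ 2 = -(q ^ 2 + k * (q ^ 2 - 4 * p ^ 2))) : ¬ RootRelation A B q (2 * p) y := by
  intro h
  -- Otherwise the formula for `y²` would make it negative.
  have hlt : q < 2 * p := by
    by_contra hle
    have h1 : (2 * p : ℝ) ≤ q := by exact_mod_cast not_lt.1 hle
    have h2 : 0 ≤ (k : ℝ) * (q ^ 2 - 4 * p ^ 2) := by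
      apply mul_nonneg (by positivity); nlinarith [(Nat.cast_nonneg p : (0 : ℝ) ≤ p)]
    nlinarith [sq_nonneg (q : ℝ), pow_pos hy 2]
  have hprime : ∀ r : ℕ, r.Prime → r ∣ q + 2 * p → r = 2 := by
    intro r hr hd
    by_contra hr2
    have hd' : (r : ℤ) ∣ q + 2 * p := by exact_mod_cast hd
    refine not_rootRelation_of_odd_prime (B := B) hA (X := q) (Z := 2 * p) (e := k * (q ^ 2 - 4 * p ^ 2)) hy
      (by push_cast; exact hy2) hr hr2 ?_ hd' (not_dvd_of_coprime hpq hr hr2 hd') (by exact_mod_cast h)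
    exact (hd'.mul_right (q - 2 * p)).trans ⟨k, by ring⟩
  rcases Nat.even_or_odd q with hqe | hqo
  · obtain ⟨s, rfl⟩ := even_iff_exists_two_mul.1 hqe
    have hpo : Odd p := by
      rw [← Nat.not_even_iff_odd]
      intro hpe
      exact absurd (Nat.dvd_gcd hpe.two_dvd hqe.two_dvd) (by rw [hpq]; decide)
    have hprime' : ∀ r : ℕ, r.Prime → r ∣ s + p → r = 2 :=
      fun r hr hd => hprime r hr (by rw [← mul_add]; exact hd.mul_left 2)
    have hso : Odd s := by
      rw [← Nat.not_even_iff_odd]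
      intro hse
      have := eq_one_of_forall_prime_eq_two (hse.add_odd hpo) hprime'
      omega
    have h4 : 4 ∣ s + p := by
      obtain ⟨m, hm⟩ := (hso.add_odd hpo).two_dvd
      rcases Nat.even_or_odd m with hme | hmo
      · obtain ⟨m', rfl⟩ := hme.two_dvd
        exact ⟨m', by omega⟩
      · have := eq_one_of_forall_prime_eq_two hmo
          (fun r hr hd => hprime' r hr (by rw [hm]; exact hd.mul_left 2))
        omega
    have hso' : Odd (s : ℤ) := by exact_mod_cast hso
    have hpo' : Odd (p : ℤ) := by exact_mod_cast hpo
    refine not_rootRelation_of_four_dvd (B := B) hA (s := s) (p := p) (e := k * (s ^ 2 - p ^ 2))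
      (Y := 1 / 2 * y) (by positivity) ?_ ((eight_dvd_sq_sub_sq hso' hpo').mul_left _) hso'
      (by exact_mod_cast h4) ?_
    · push_cast at hy2 ⊢
      linear_combination hy2 / 4
    · convert h.scale (1 / 2) using 1
      · push_cast; ring
      · push_cast; ring
  · have := eq_one_of_forall_prime_eq_two (hqo.add_even (even_two_mul p)) hprime
    omega

theorem eq_one_or_three_of_prime_eq_three {m : ℕ} (hm : Odd m)
    (h : ∀ r : ℕ, r.Prime → r ∣ m → r = 2 ∨ r = 3) (h9 : ¬ 9 ∣ m) : m = 1 ∨ m = 3 := by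
  by_cases h3 : 3 ∣ m
  · obtain ⟨k, rfl⟩ := h3
    right
    have := eq_one_of_forall_prime_eq_two (Nat.odd_mul.1 hm).2 (fun r hr hd => by
      rcases h r hr (hd.mul_left 3) with h | rfl
      · exact h
      · exact absurd (mul_dvd_mul_left 3 hd) h9)
    omega
  · exact .inl (eq_one_of_forall_prime_eq_two hm (fun r hr hd => by
      rcases h r hr hd with h | rfl
      · exact h
      · exact absurd hd h3))

/-- Here `y²` has denominator 3, so the prime 3 survives in `q + 2p`, but only to the first power:
if `9 ∣ q + 2p`, the denominator cancels and reduction modulo 3 applies. The bound `q < p` leaves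
only `q = 2s` with `s + p = 6`. -/
theorem eq_five_two_of_rootRelation {A B : ℕ} (hA : A ≠ 0) {p q : ℕ} (hq : 0 < q)
    (hpq : p.Coprime q) {y : ℝ} (hy : 0 < y) (hy2 : 3 * y ^ 2 = 4 * (p ^ 2 - q ^ 2))
    (h : RootRelation A B q (2 * p) y) : p = 5 ∧ q = 2 := by
  have hlt : q < p := by
    by_contra hle
    have h1 : (p : ℝ) ≤ q := by exact_mod_cast not_lt.1 hle
    nlinarith [pow_pos hy 2, (Nat.cast_nonneg p : (0 : ℝ) ≤ p)]
  have h9 : ¬ 9 ∣ q + 2 * p := by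
    intro hd
    have hd' : ((3 : ℕ) : ℤ) ∣ q + 2 * p := by
      exact_mod_cast (show 3 ∣ 9 by decide).trans hd
    obtain ⟨u, hu⟩ := hd
    have hu' : (q : ℤ) = 9 * u - 2 * p := by
      have : (q : ℤ) + 2 * p = 9 * u := by exact_mod_cast hu
      linarith
    refine not_rootRelation_of_odd_prime (B := B) hA (X := q) (Z := 2 * p) (e := 3 * u * (q - 2 * p)) hy
      ?_ Nat.prime_three (by decide) ⟨u * (q - 2 * p), by push_cast; ring⟩ hd'
      (not_dvd_of_coprime hpq Nat.prime_three (by decide) hd') (by exact_mod_cast h)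
    have hu2 : (q : ℝ) + 2 * p = 9 * u := by exact_mod_cast hu
    push_cast
    linear_combination hy2 / 3 - (q - 2 * p) / 3 * hu2
  have hprime : ∀ r : ℕ, r.Prime → r ∣ q + 2 * p → r = 2 ∨ r = 3 := by
    intro r hr hd
    by_contra! hr2
    have hd' : (r : ℤ) ∣ q + 2 * p := by exact_mod_cast hd
    -- Scaling the relation by 3 makes the square of `Y` an integer; this is harmless as `r ≠ 3`.
    refine not_rootRelation_of_odd_prime (B := B) hA (X := 3 * q) (Z := 6 * p) (e := 3 * (q ^ 2 - 4 * p ^ 2))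
      (Y := 3 * y) (by positivity) (by push_cast; linear_combination 3 * hy2) hr hr2.1 ?_ ?_ ?_ ?_
    · exact (hd'.mul_right (q - 2 * p)).trans ⟨3, by ring⟩
    · exact hd'.trans ⟨3, by ring⟩
    · intro h3
      have h3' : r ∣ 3 * q := by exact_mod_cast h3
      rcases hr.dvd_mul.1 h3' with h | h
      · exact hr2.2 ((Nat.prime_dvd_prime_iff_eq hr Nat.prime_three).1 h)
      · exact not_dvd_of_coprime hpq hr hr2.1 hd' (by exact_mod_cast h)
    · convert h.scale 3 using 1
      · push_cast; ring
      · push_cast; ring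
  rcases Nat.even_or_odd q with hqe | hqo
  · obtain ⟨s, rfl⟩ := even_iff_exists_two_mul.1 hqe
    have hpo : Odd p := by
      rw [← Nat.not_even_iff_odd]
      intro hpe
      exact absurd (Nat.dvd_gcd hpe.two_dvd hqe.two_dvd) (by rw [hpq]; decide)
    have hprime' : ∀ r : ℕ, r.Prime → r ∣ s + p → r = 2 ∨ r = 3 :=
      fun r hr hd => hprime r hr (by rw [← mul_add]; exact hd.mul_left 2)
    have h9' : ¬ 9 ∣ s + p := fun hd => h9 (by rw [← mul_add]; exact hd.mul_left 2)
    have hso : Odd s := by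
      rw [← Nat.not_even_iff_odd]
      intro hse
      have := eq_one_or_three_of_prime_eq_three (hse.add_odd hpo) hprime' h9'
      obtain ⟨a, rfl⟩ := hse
      omega
    obtain ⟨m, hm⟩ := (hso.add_odd hpo).two_dvd
    rcases Nat.even_or_odd m with hme | hmo
    · exfalso
      have h4 : 4 ∣ s + p := by
        obtain ⟨m', rfl⟩ := hme.two_dvd
        exact ⟨m', by omega⟩
      have hso' : Odd ((3 * s : ℕ) : ℤ) := by exact_mod_cast (Nat.odd_mul.2 ⟨by decide, hso⟩)
      have hpo' : Odd ((3 * p : ℕ) : ℤ) := by exact_mod_cast (Nat.odd_mul.2 ⟨by decide, hpo⟩)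
      have h8 := eight_dvd_sq_sub_sq (s := s) (p := p) (by exact_mod_cast hso)
        (by exact_mod_cast hpo)
      refine not_rootRelation_of_four_dvd (B := B) hA (s := (3 * s : ℕ)) (p := (3 * p : ℕ))
        (e := 3 * (s ^ 2 - p ^ 2)) (Y := 3 / 2 * y) (by positivity) ?_ (h8.mul_left _) hso'
        ?_ ?_
      · push_cast at hy2 ⊢
        linear_combination hy2 * (3 / 4)
      · have : 4 ∣ 3 * s + 3 * p := by omega
        exact_mod_cast this
      · convert h.scale (3 / 2) using 1
        · push_cast; ring
        · push_cast; ring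
    · have hm13 := eq_one_or_three_of_prime_eq_three hmo
        (fun r hr hd => hprime' r hr (by rw [hm]; exact hd.mul_left 2))
        (fun hd => h9' (by rw [hm]; exact hd.mul_left 2))
      obtain ⟨s', rfl⟩ := hso
      rcases hm13 with rfl | rfl
      · omega
      · have : s' = 0 ∨ s' = 1 := by omega
        rcases this with rfl | rfl <;> omega
  · have := eq_one_or_three_of_prime_eq_three (hqo.add_even (even_two_mul p)) hprime h9
    omega

/-! ### Arithmetic of the two dihedral angles for `c = 0, -1/2, 1/2`. -/

/-- The trigonometric data of a right pyramid of height `h` over a regular polygon with central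
angle of cosine `c`: `a` and `b` are the dihedral angles at the base and at the lateral edges. -/
structure PyramidAngles (c h a b : ℝ) : Prop where
  c_gt : -1 < c
  c_lt : c < 1
  h_pos : 0 < h
  a_pos : 0 < a
  a_lt : a < Real.pi / 2
  b_nonneg : 0 ≤ b
  b_le : b ≤ Real.pi
  -- `(1 + c)/2` is the square of the inradius of the base, so this says that `tan² a = h² / ((1 +
  -- c)/2)`.
  cos_two_a : Real.cos (2 * a) = ((1 + c) / 2 - h ^ 2) / ((1 + c) / 2 + h ^ 2)
  cos_b : Real.cos b = -(2 * c * h ^ 2 + 1 + c) / (1 + c + 2 * h ^ 2)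

namespace PyramidAngles

variable {c h a b : ℝ}

/-- The number `y = q tan a` gives `tan a = y/q`, and the proportionality of the lengths turns the
formula for `cos b` into `tan (b/2) = 2p/y`. Both exponentials then lie in the same quadratic field.
-/
theorem exists_rootRelation (H : PyramidAngles c h a b) {p q : ℕ} (hp : 0 < p) (hq : 0 < q)
    (hl : q * √(1 + h ^ 2) = p * √(2 - 2 * c)) (hr : (q * a + p * b : ℝ) ∈ ratPi) :
    ∃ y A B, A ≠ 0 ∧ 0 < y ∧ (1 + c) * y ^ 2 = 2 * ((2 - 2 * c) * p ^ 2 - q ^ 2) ∧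
      RootRelation A B q (2 * p) y := by
  have hc := H.c_gt
  have hc' := H.c_lt
  have hh := H.h_pos
  have hM : 0 < (1 + c) / 2 := by linarith
  have hp' : (0 : ℝ) < p := by exact_mod_cast hp
  have hq' : (0 : ℝ) < q := by exact_mod_cast hq
  have hl2 : (q : ℝ) ^ 2 * (1 + h ^ 2) = p ^ 2 * (2 - 2 * c) := by
    have := congrArg (· ^ 2) hl
    beta_reduce at this
    rwa [mul_pow, mul_pow, Real.sq_sqrt (by positivity), Real.sq_sqrt (by linarith)] at this
  obtain ⟨y, hy, hy2⟩ : ∃ y : ℝ, 0 < y ∧ y ^ 2 = q ^ 2 * h ^ 2 / ((1 + c) / 2) :=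
    ⟨q * h / √((1 + c) / 2), by positivity, by rw [div_pow, mul_pow, Real.sq_sqrt hM.le]⟩
  have hp2 : (2 * p : ℝ) ^ 2 = 2 * q ^ 2 * (1 + h ^ 2) / (1 - c) := by
    rw [eq_div_iff (by linarith)]; linear_combination -2 * hl2
  have h1c : (1 : ℝ) - c ≠ 0 := by linarith
  have h1c' : (1 : ℝ) + c ≠ 0 := by linarith
  obtain ⟨N, hN, hrel⟩ := _root_.exists_rootRelation (α := 2 * a) (β := b) (X := q) (Y := y)
    -- The exponents come from doubling `q a + p b` to `q (2a) + (2p) b`.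
    (Z := 2 * p) (A := q) (B := 2 * p) (by linarith [H.a_pos]) (by linarith [H.a_lt]) H.b_nonneg
    H.b_le hq' hy (by positivity) (by
      rw [H.cos_two_a, hy2]
      field_simp) (by
      have h1 : 0 < 1 - c := by linarith
      have h2 : 0 < 1 + c := by linarith
      rw [H.cos_b, hp2, hy2, div_eq_div_iff (by positivity) (by positivity)]
      field_simp; ring) (by
      have := int_mul_mem_ratPi 2 hr
      push_cast at this ⊢
      convert this using 1
      ring)
  refine ⟨y, q * N, 2 * p * N, mul_ne_zero hq.ne' hN, hy, ?_, hrel⟩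
  rw [hy2]
  field_simp
  linear_combination hl2

theorem two_mul_a_mem (ha : a ∈ ratPi) : 2 * a ∈ ratPi := by
  simpa using int_mul_mem_ratPi 2 ha

theorem cos_two_a_eq_zero (H : PyramidAngles c h a b) (ha : a ∈ ratPi)
    (hi : IsIntegral ℤ (Real.cos (2 * a))) : Real.cos (2 * a) = 0 :=
  cos_eq_zero_of_isIntegral (two_mul_a_mem ha) (by linarith [H.a_pos]) (by linarith [H.a_lt]) hi

theorem not_dependent_of_zero (H : PyramidAngles 0 h a b) {p q : ℕ} (hp : 0 < p) (hq : 0 < q)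
    (hpq : p.Coprime q) (hl : q * √(1 + h ^ 2) = p * √(2 - 2 * 0)) :
    (q * a + p * b : ℝ) ∉ ratPi := by
  intro hr
  obtain ⟨y, A, B, hA, hy, hy2, hrel⟩ := H.exists_rootRelation hp hq hl hr
  refine not_rootRelation_of_sq_eq hA hq hpq hy (k := 1) ?_ hrel
  push_cast
  linear_combination hy2

theorem not_dependent_of_neg_half (H : PyramidAngles (-1 / 2) h a b) {p q : ℕ} (hp : 0 < p)
    (hq : 0 < q) (hpq : p.Coprime q) (hl : q * √(1 + h ^ 2) = p * √(2 - 2 * (-1 / 2))) :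
    (q * a + p * b : ℝ) ∉ ratPi := by
  intro hr
  obtain ⟨y, A, B, hA, hy, hy2, hrel⟩ := H.exists_rootRelation hp hq hl hr
  refine not_rootRelation_of_sq_eq hA hq hpq hy (k := 3) ?_ hrel
  push_cast
  linear_combination 2 * hy2

theorem not_mem_ratPi_of_cos_eq {x : ℝ} (q : ℚ) (hq : Real.cos x = q)
    (hq' : (q : ℝ) ∉ ({-1, -1 / 2, 0, 1 / 2, 1} : Set ℝ)) : x ∉ ratPi := by
  intro hx
  apply hq'
  rw [← hq]
  exact niven (mem_ratPi.1 hx) ⟨q, hq⟩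

theorem not_dependent_of_half (H : PyramidAngles (1 / 2) h a b) {p q : ℕ} (hp : 0 < p)
    (hq : 0 < q) (hpq : p.Coprime q) (hl : q * √(1 + h ^ 2) = p * √(2 - 2 * (1 / 2))) :
    (q * a + p * b : ℝ) ∉ ratPi := by
  intro hr
  obtain ⟨y, A, B, hA, hy, hy2, hrel⟩ := H.exists_rootRelation hp hq hl hr
  obtain ⟨rfl, rfl⟩ := eq_five_two_of_rootRelation hA hq hpq hy (by linear_combination 2 * hy2) hrel
  have hh : h ^ 2 = 21 / 4 := by
    have := congrArg (· ^ 2) hl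
    beta_reduce at this
    rw [mul_pow, mul_pow, Real.sq_sqrt (by positivity), Real.sq_sqrt (by norm_num)] at this
    push_cast at this
    linarith
  have ha : Real.cos (2 * a) = -3 / 4 := by rw [H.cos_two_a, hh]; norm_num
  have hb : Real.cos b = -9 / 16 := by rw [H.cos_b, hh]; norm_num
  -- The exceptional pair gives `h² = 21/4`. This coincidence yields `6a = ±(π - b)` modulo `2π`;
  -- substituted in `2a + 5b`, it leaves `-14` or `16` times `2a`, so that `2a` itself is a rational
  -- multiple of `π`.
  have h3 : Real.cos (3 * (2 * a)) = Real.cos (Real.pi - b) := by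
    rw [Real.cos_three_mul, Real.cos_pi_sub, ha, hb]; norm_num
  obtain ⟨k, hk⟩ := Real.cos_eq_cos_iff.1 h3
  have hπ : ∀ m : ℤ, m * Real.pi ∈ ratPi := fun m => int_mul_mem_ratPi m pi_mem_ratPi
  have h2a : 2 * a ∈ ratPi := by
    push_cast at hr
    rcases hk with hk | hk
    · have e : ((-14 : ℤ) : ℝ) * (2 * a) ∈ ratPi := by
        have := sub_mem hr (hπ (5 * (1 - 2 * k)))
        convert this using 1
        push_cast
        linear_combination 5 * hk
      exact mem_ratPi_of_int_mul (by norm_num) e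
    · have e : ((16 : ℤ) : ℝ) * (2 * a) ∈ ratPi := by
        have := sub_mem hr (hπ (5 * (1 - 2 * k)))
        convert this using 1
        push_cast
        linear_combination 5 * hk
      exact mem_ratPi_of_int_mul (by norm_num) e
  exact not_mem_ratPi_of_cos_eq (-3 / 4) (by rw [ha]; norm_num) (by norm_num) h2a

/-- The relation `cos 2a = -1 - 2 cos b` shows that `cos 2a` is an algebraic integer, hence 0, and
this means `h² = (1 + c)/2 = 1/2`. -/
theorem height_of_rational (H : PyramidAngles 0 h a b) (ha : a ∈ ratPi) (hb : b ∈ ratPi) :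
    h = 1 / √2 := by
  have hrel : Real.cos (2 * a) = -1 - 2 * Real.cos b := by
    have hh := H.h_pos
    rw [H.cos_two_a, H.cos_b]; field_simp; ring
  have h0 := H.cos_two_a_eq_zero ha (by
    rw [hrel]
    exact isIntegral_one.neg.sub (isIntegral_two_mul_cos hb))
  rw [H.cos_two_a, div_eq_zero_iff] at h0
  have hh := H.h_pos
  have h2 : h ^ 2 = 1 / 2 := by
    rcases h0 with h0 | h0
    · linarith
    · exfalso; have := pow_pos hh 2; linarith
  rw [one_div, ← Real.sqrt_inv, eq_comm, Real.sqrt_eq_iff_mul_self_eq (by norm_num) hh.le]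
  linarith

theorem rational_of_height (H : PyramidAngles 0 (1 / √2) a b) : a ∈ ratPi ∧ b ∈ ratPi := by
  have hs : ((1 : ℝ) / √2) ^ 2 = 1 / 2 := by
    rw [div_pow, Real.sq_sqrt (by norm_num)]; norm_num
  have ha := H.cos_two_a
  have hb := H.cos_b
  rw [hs] at ha hb
  constructor
  · have h1 : Real.cos (2 * a) = Real.cos (Real.pi / 2) := by rw [ha, Real.cos_pi_div_two]; norm_num
    have h2 := Real.injOn_cos ⟨by linarith [H.a_pos], by linarith [H.a_lt]⟩
      ⟨by positivity, by linarith [Real.pi_pos]⟩ h1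
    exact mem_ratPi.2 ⟨1 / 4, by push_cast; linarith⟩
  · have h1 : Real.cos b = Real.cos (Real.pi - Real.pi / 3) := by
      rw [hb, Real.cos_pi_sub, Real.cos_pi_div_three]; norm_num
    have h2 := Real.injOn_cos ⟨H.b_nonneg, H.b_le⟩
      ⟨by linarith [Real.pi_pos], by linarith [Real.pi_pos]⟩ h1
    exact mem_ratPi.2 ⟨2 / 3, by push_cast; linarith⟩

theorem not_rational_of_half (H : PyramidAngles (1 / 2) h a b) : ¬ (a ∈ ratPi ∧ b ∈ ratPi) := by
  rintro ⟨ha, hb⟩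
  have hrel : Real.cos (2 * a) = -((3 : ℕ) : ℝ) - (2 * Real.cos b + 2 * Real.cos b) := by
    have hh := H.h_pos
    rw [H.cos_two_a, H.cos_b]; field_simp; push_cast; ring
  have hi := isIntegral_two_mul_cos hb
  have h0 := H.cos_two_a_eq_zero ha (by
    rw [hrel]
    exact (isIntegral_natCast 3).neg.sub (hi.add hi))
  refine not_mem_ratPi_of_cos_eq (x := b) (-3 / 4) ?_ (by norm_num) hb
  rw [h0] at hrel
  push_cast at hrel ⊢
  linarith

theorem not_rational_of_neg_half (H : PyramidAngles (-1 / 2) h a b) :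
    ¬ (a ∈ ratPi ∧ b ∈ ratPi) := by
  rintro ⟨ha, hb⟩
  -- The relation is `3 cos 2a = -1 - 4 cos b`. Leaving `2 cos 2a` on the right is deliberate: it is
  -- an algebraic integer, which makes `cos 2a` one without division by 3.
  have hrel : Real.cos (2 * a) = -1 - 2 * Real.cos b - 2 * Real.cos b - 2 * Real.cos (2 * a) := by
    have hh := H.h_pos
    have : (0 : ℝ) < 1 + 2 ^ 2 * h ^ 2 := by positivity
    rw [H.cos_two_a, H.cos_b]; field_simp; ring
  have hi := isIntegral_two_mul_cos hb
  have h0 := H.cos_two_a_eq_zero ha (by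
    rw [hrel]
    exact ((isIntegral_one.neg.sub hi).sub hi).sub (isIntegral_two_mul_cos (two_mul_a_mem ha)))
  refine not_mem_ratPi_of_cos_eq (x := b) (-1 / 4) ?_ (by norm_num) hb
  rw [h0] at hrel
  push_cast at hrel ⊢
  linarith

end PyramidAngles

/-! ### Faces of a convex hull. -/

/-- `S` is the set of the points of `V` at which some linear functional is maximal on `V`. -/
def IsArgmax (V S : Set E3) : Prop :=
  ∃ (l : StrongDual ℝ E3) (M : ℝ), (∀ v ∈ V, l v ≤ M) ∧ S = {v ∈ V | l v = M}

theorem le_of_mem_convexHull {V : Set E3} {l : StrongDual ℝ E3} {M : ℝ} (h : ∀ v ∈ V, l v ≤ M)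
    {x : E3} (hx : x ∈ convexHull ℝ V) : l x ≤ M :=
  convexHull_min (t := {x | l x ≤ M}) h (convex_halfSpace_le l.toLinearMap.isLinear M) hx

/-- A convex combination reaches the bound `M` only if it puts no weight on generators where `l` is
smaller: a point of the hull lies on a segment between the hulls of the two kinds of generators. -/
theorem convexHull_sep_eq {V : Set E3} {l : StrongDual ℝ E3} {M : ℝ} (h : ∀ v ∈ V, l v ≤ M) :
    convexHull ℝ {v ∈ V | l v = M} = {x ∈ convexHull ℝ V | l x = M} := by
  apply subset_antisymm
  · apply convexHull_min
    · exact fun v hv => ⟨subset_convexHull ℝ V hv.1, hv.2⟩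
    · exact (convex_convexHull ℝ V).inter (convex_hyperplane l.toLinearMap.isLinear M)
  · rintro x ⟨hx, hxM⟩
    set S := {v ∈ V | l v = M}
    set T := {v ∈ V | l v < M}
    have hST : V = S ∪ T := by
      ext v
      constructor
      · intro hv
        rcases (h v hv).eq_or_lt with h' | h'
        · exact .inl ⟨hv, h'⟩
        · exact .inr ⟨hv, h'⟩
      · rintro (hv | hv) <;> exact hv.1
    have hT : ∀ y ∈ convexHull ℝ T, l y < M := fun y hy =>
      convexHull_min (t := {x | l x < M}) (fun v hv => hv.2)
        (convex_halfSpace_lt l.toLinearMap.isLinear M) hy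
    rcases T.eq_empty_or_nonempty with hT0 | hTne
    · rwa [hST, hT0, Set.union_empty] at hx
    rcases S.eq_empty_or_nonempty with hS0 | hSne
    · rw [hST, hS0, Set.empty_union] at hx
      exact absurd hxM (hT x hx).ne
    rw [hST, convexHull_union hSne hTne, mem_convexJoin] at hx
    obtain ⟨y, hy, z, hz, a, b, ha, hb, hab, rfl⟩ := hx
    have hyM : l y ≤ M := le_of_mem_convexHull (V := S) (fun v hv => hv.2.le) hy
    rcases hb.eq_or_lt with rfl | hb
    · obtain rfl : a = 1 := by linarith
      simpa using hy
    · rw [map_add, map_smul, map_smul, smul_eq_mul, smul_eq_mul] at hxM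
      have h1 := mul_lt_mul_of_pos_left (hT z hz) hb
      have h2 := mul_le_mul_of_nonneg_left hyM ha
      have h3 : a * M + b * M = M := by rw [← add_mul, hab, one_mul]
      linarith

theorem IsArgmax.inter_convexHull {V S : Set E3} (h : IsArgmax V S) : V ∩ convexHull ℝ S = S := by
  obtain ⟨l, M, hM, rfl⟩ := h
  rw [convexHull_sep_eq hM]
  ext v
  exact ⟨fun hv => ⟨hv.1, hv.2.2⟩, fun hv => ⟨hv.1, subset_convexHull ℝ V hv.1, hv.2⟩⟩

theorem IsArgmax.convexHull_subset_iff {V S T : Set E3} (hS : IsArgmax V S) (hT : IsArgmax V T) :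
    convexHull ℝ S ⊆ convexHull ℝ T ↔ S ⊆ T := by
  refine ⟨fun h => ?_, fun h => convexHull_mono h⟩
  rw [← hS.inter_convexHull, ← hT.inter_convexHull]
  exact Set.inter_subset_inter_right V h

theorem IsArgmax.convexHull_inj {V S T : Set E3} (hS : IsArgmax V S) (hT : IsArgmax V T) :
    convexHull ℝ S = convexHull ℝ T ↔ S = T := by
  rw [Set.Subset.antisymm_iff, Set.Subset.antisymm_iff, hS.convexHull_subset_iff hT,
    hT.convexHull_subset_iff hS]

/-- The sum of the two functionals reaches the sum of the two bounds exactly where each reaches its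
own, so the intersection is again of the form treated by `convexHull_sep_eq`. -/
theorem IsArgmax.convexHull_inter {V S T : Set E3} (hS : IsArgmax V S) (hT : IsArgmax V T) :
    convexHull ℝ S ∩ convexHull ℝ T = convexHull ℝ (S ∩ T) := by
  obtain ⟨l, M, hM, rfl⟩ := hS
  obtain ⟨l', M', hM', rfl⟩ := hT
  have key : ∀ x ∈ convexHull ℝ V, (l + l') x = M + M' ↔ l x = M ∧ l' x = M' := by
    intro x hx
    have h1 := le_of_mem_convexHull hM hx
    have h2 := le_of_mem_convexHull hM' hx
    rw [add_apply]
    constructor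
    · intro h; constructor <;> linarith
    · rintro ⟨h, h'⟩; rw [h, h']
  have hsum : ∀ v ∈ V, (l + l') v ≤ M + M' := fun v hv => add_le_add (hM v hv) (hM' v hv)
  have hset : {v ∈ V | l v = M} ∩ {v ∈ V | l' v = M'} = {v ∈ V | (l + l') v = M + M'} := by
    ext v
    constructor
    · rintro ⟨h, h'⟩
      exact ⟨h.1, (key v (subset_convexHull ℝ V h.1)).2 ⟨h.2, h'.2⟩⟩
    · rintro ⟨hv, h⟩
      have := (key v (subset_convexHull ℝ V hv)).1 h
      exact ⟨⟨hv, this.1⟩, hv, this.2⟩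
  rw [hset, convexHull_sep_eq hM, convexHull_sep_eq hM', convexHull_sep_eq hsum]
  ext x
  constructor
  · rintro ⟨h, h'⟩
    exact ⟨h.1, (key x h.1).2 ⟨h.2, h'.2⟩⟩
  · rintro ⟨hx, h⟩
    have := (key x hx).1 h
    exact ⟨⟨hx, this.1⟩, hx, this.2⟩

theorem vectorSpan_convexHull (S : Set E3) : vectorSpan ℝ (convexHull ℝ S) = vectorSpan ℝ S := by
  rw [← direction_affineSpan, affineSpan_convexHull, direction_affineSpan]

theorem mem_faces_convexHull_iff {V F : Set E3} {k : ℕ} :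
    F ∈ faces (convexHull ℝ V) k ↔ ∃ S : Set E3, S.Nonempty ∧ IsArgmax V S ∧ F = convexHull ℝ S ∧
      Module.finrank ℝ (vectorSpan ℝ S) = k := by
  constructor
  · rintro ⟨hne, hexp, hk⟩
    obtain ⟨l, hl⟩ := hexp hne
    obtain ⟨x, hx⟩ := hne
    rw [hl] at hx
    have hM : ∀ v ∈ V, l v ≤ l x := fun v hv => hx.2 v (subset_convexHull ℝ V hv)
    have hF : F = convexHull ℝ {v ∈ V | l v = l x} := by
      rw [convexHull_sep_eq hM, hl]
      ext y
      constructor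
      · rintro ⟨hy, hy'⟩
        exact ⟨hy, le_antisymm (hx.2 y hy) (hy' x hx.1)⟩
      · rintro ⟨hy, hy'⟩
        exact ⟨hy, fun z hz => hy' ▸ hx.2 z hz⟩
    refine ⟨_, ?_, ⟨l, l x, hM, rfl⟩, hF, ?_⟩
    · rw [← convexHull_nonempty_iff (𝕜 := ℝ), ← hF, hl]
      exact ⟨x, hx⟩
    · rw [← vectorSpan_convexHull, ← hF, hk]
  · rintro ⟨S, hne, ⟨l, M, hM, hS⟩, rfl, hk⟩
    refine ⟨hne.convexHull, fun _ => ⟨l, ?_⟩, by rw [vectorSpan_convexHull, hk]⟩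
    obtain ⟨v, hv⟩ := hne
    rw [hS] at hv ⊢
    rw [convexHull_sep_eq hM]
    ext y
    constructor
    · rintro ⟨hy, hy'⟩
      exact ⟨hy, fun z hz => hy' ▸ le_of_mem_convexHull hM hz⟩
    · rintro ⟨hy, hy'⟩
      refine ⟨hy, le_antisymm (le_of_mem_convexHull hM hy) ?_⟩
      rw [← hv.2]
      exact hy' v (subset_convexHull ℝ V hv.1)

/-! ### Computing dihedral angles from half-planes. -/

/-- Each of the two facets lies in a half-plane bounded by the line of `e`, spanned by `d` and a
vector `f` or `g` orthogonal to `d`. An admissible vector perpendicular to the edge is then a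
positive multiple of `f` or `g`, so the set of admissible angles is a singleton and its supremum is
the angle between them. -/
theorem dihedralAngle_eq_angle {P e F G : Set E3} {m d f g : E3} (he : e ∈ edges P)
    (hF : F ∈ facets P) (hG : G ∈ facets P) (hFG : F ∩ G = e)
    (hall : ∀ K ∈ facets P, e ⊆ K → K = F ∨ K = G) (hm : m ∈ e)
    (hd : ∃ ε : ℝ, ε ≠ 0 ∧ m + ε • d ∈ e) (hed : ∀ x ∈ e, ∃ α : ℝ, x = m + α • d) (hd0 : d ≠ 0)
    (hfd : inner ℝ f d = 0) (hgd : inner ℝ g d = 0)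
    (hFd : ∀ x ∈ F, ∃ α β : ℝ, 0 ≤ β ∧ x = m + α • d + β • f)
    (hGd : ∀ x ∈ G, ∃ α β : ℝ, 0 ≤ β ∧ x = m + α • d + β • g)
    (hf0 : f ≠ 0) (hg0 : g ≠ 0)
    (hfF : ∃ β : ℝ, 0 < β ∧ m + β • f ∈ F) (hgG : ∃ β : ℝ, 0 < β ∧ m + β • g ∈ G) :
    dihedralAngle P e = InnerProductGeometry.angle f g := by
  have hperp : ∀ u : E3, inner ℝ u d = 0 → ∀ p m' : E3, m' ∈ e → p ≠ m' →
      (∃ α β : ℝ, 0 ≤ β ∧ p = m + α • d + β • u) → (∀ x ∈ e, inner ℝ (p - m') (x - m') = 0) →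
      ∃ β : ℝ, 0 < β ∧ p - m' = β • u := by
    rintro u hu p m' hm' hne ⟨α, β, hβ, rfl⟩ hx
    obtain ⟨μ, rfl⟩ := hed m' hm'
    obtain ⟨ε, hε, hεe⟩ := hd
    have e1 : m + α • d + β • u - (m + μ • d) = (α - μ) • d + β • u := by module
    have e2 : m + ε • d - (m + μ • d) = (ε - μ) • d := by module
    have e3 : m - (m + μ • d) = (-μ) • d := by module
    have h1 := hx _ hεe
    have h2 := hx _ hm
    rw [e1, e2, inner_smul_right, inner_add_left, inner_smul_left, inner_smul_left, hu] at h1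
    rw [e1, e3, inner_smul_right, inner_add_left, inner_smul_left, inner_smul_left, hu] at h2
    have hdd : inner ℝ d d ≠ 0 := inner_self_ne_zero.2 hd0
    have hαμ : α - μ = 0 := by
      have h3 : ε * ((α - μ) * inner ℝ d d) = 0 := by
        simp only [conj_trivial, mul_zero, add_zero] at h1 h2
        linear_combination h1 - h2
      exact (mul_eq_zero.1 ((mul_eq_zero.1 h3).resolve_left hε)).resolve_right hdd
    rw [e1, hαμ, zero_smul, zero_add]
    refine ⟨β, hβ.lt_of_ne ?_, rfl⟩
    rintro rfl
    apply hne
    rw [zero_smul, add_zero, sub_eq_zero.1 hαμ]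
  have hset : {α | IsDihedralAngle P e α} = {InnerProductGeometry.angle f g} := by
    apply subset_antisymm
    · rintro α ⟨F', hF', G', hG', hFG', m', hm', p, hp, q, hq, hpm, hqm, hpe, hqe, rfl⟩
      -- Equal facets would intersect in a set of dimension 2, not in an edge.
      have hne : F' ≠ G' := by
        rintro rfl
        rw [Set.inter_self] at hFG'
        have h1 := hF'.2.2
        rw [hFG', he.2.2] at h1
        exact absurd h1 (by norm_num)
      have h1 := hall F' hF' (hFG' ▸ Set.inter_subset_left)
      have h2 := hall G' hG' (hFG' ▸ Set.inter_subset_right)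
      rw [Set.mem_singleton_iff, EuclideanGeometry.angle, vsub_eq_sub, vsub_eq_sub]
      rcases h1 with rfl | rfl <;> rcases h2 with rfl | rfl
      · exact absurd rfl hne
      · obtain ⟨β, hβ, e1⟩ := hperp f hfd p m' hm' hpm (hFd p hp) hpe
        obtain ⟨β', hβ', e2⟩ := hperp g hgd q m' hm' hqm (hGd q hq) hqe
        rw [e1, e2, InnerProductGeometry.angle_smul_left_of_pos _ _ hβ,
          InnerProductGeometry.angle_smul_right_of_pos _ _ hβ']
      · obtain ⟨β, hβ, e1⟩ := hperp g hgd p m' hm' hpm (hGd p hp) hpe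
        obtain ⟨β', hβ', e2⟩ := hperp f hfd q m' hm' hqm (hFd q hq) hqe
        rw [e1, e2, InnerProductGeometry.angle_smul_left_of_pos _ _ hβ,
          InnerProductGeometry.angle_smul_right_of_pos _ _ hβ', InnerProductGeometry.angle_comm]
      · exact absurd rfl hne
    · rw [Set.singleton_subset_iff]
      obtain ⟨β, hβ, hfF⟩ := hfF
      obtain ⟨β', hβ', hgG⟩ := hgG
      have hort : ∀ u : E3, inner ℝ u d = 0 → ∀ γ : ℝ, ∀ x ∈ e,
          inner ℝ (m + γ • u - m) (x - m) = 0 := by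
        intro u hu γ x hx
        obtain ⟨α, rfl⟩ := hed x hx
        rw [add_sub_cancel_left, add_sub_cancel_left, inner_smul_left, inner_smul_right, hu]
        simp
      refine ⟨F, hF, G, hG, hFG, m, hm, _, hfF, _, hgG, ?_, ?_, hort f hfd β, hort g hgd β', ?_⟩
      · simp [hβ.ne', hf0]
      · simp [hβ'.ne', hg0]
      · rw [EuclideanGeometry.angle, vsub_eq_sub, vsub_eq_sub, add_sub_cancel_left,
          add_sub_cancel_left, InnerProductGeometry.angle_smul_left_of_pos _ _ hβ,
          InnerProductGeometry.angle_smul_right_of_pos _ _ hβ']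
  rw [dihedralAngle, hset, csSup_singleton]

theorem convex_halfPlane (m d f : E3) :
    Convex ℝ {x : E3 | ∃ α β : ℝ, 0 ≤ β ∧ x = m + α • d + β • f} := by
  rintro x ⟨α, β, hβ, rfl⟩ y ⟨α', β', hβ', rfl⟩ a b ha hb hab
  refine ⟨a * α + b * α', a * β + b * β', by positivity, ?_⟩
  obtain rfl : b = 1 - a := by linarith
  module

theorem triangle_mem_halfPlane (A B C : E3) (t : ℝ) {x : E3} (hx : x ∈ convexHull ℝ {A, B, C}) :
    ∃ α β : ℝ, 0 ≤ β ∧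
      x = midpoint ℝ A B + α • (B - A) + β • (C - A - t • (B - A)) := by
  refine convexHull_min ?_ (convex_halfPlane _ _ _) hx
  rw [midpoint_eq_smul_add]
  rintro y (rfl | rfl | rfl)
  · refine ⟨-1 / 2, 0, le_rfl, ?_⟩; simp only [invOf_eq_inv]; module
  · refine ⟨1 / 2, 0, le_rfl, ?_⟩; simp only [invOf_eq_inv]; module
  · refine ⟨t - 1 / 2, 1, zero_le_one, ?_⟩; simp only [invOf_eq_inv]; module

theorem segment_mem_line (A B : E3) {x : E3} (hx : x ∈ convexHull ℝ {A, B}) :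
    ∃ α : ℝ, x = midpoint ℝ A B + α • (B - A) := by
  rw [convexHull_pair] at hx
  obtain ⟨a, b, ha, hb, hab, rfl⟩ := hx
  obtain rfl : b = 1 - a := by linarith
  refine ⟨1 / 2 - a, ?_⟩
  rw [midpoint_eq_smul_add]; simp only [invOf_eq_inv]; module

theorem midpoint_mem_segment_hull (A B : E3) : midpoint ℝ A B ∈ convexHull ℝ {A, B} := by
  rw [convexHull_pair]; exact midpoint_mem_segment A B

theorem exists_midpoint_add_mem_segment (A B : E3) :
    ∃ ε : ℝ, ε ≠ 0 ∧ midpoint ℝ A B + ε • (B - A) ∈ convexHull ℝ {A, B} := by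
  refine ⟨1 / 2, by norm_num, ?_⟩
  have : midpoint ℝ A B + (1 / 2 : ℝ) • (B - A) = B := by
    rw [midpoint_eq_smul_add]; simp only [invOf_eq_inv]; module
  rw [this]
  exact subset_convexHull ℝ _ (by simp)

theorem exists_midpoint_add_mem_triangle (A B C : E3) (t : ℝ) :
    ∃ β : ℝ, 0 < β ∧
      midpoint ℝ A B + β • (C - A - t • (B - A)) ∈ convexHull ℝ {A, B, C} := by
  have h1 : 0 < 1 + |t| := by positivity
  -- Small enough for the barycentric coordinates `1/2 - β + βt`, `1/2 - βt`, `β` to be nonnegative.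
  refine ⟨1 / (2 * (1 + |t|)), by positivity, ?_⟩
  set β := 1 / (2 * (1 + |t|)) with hβ
  have hβ0 : 0 < β := by positivity
  have hβ1 : β * (1 + |t|) = 1 / 2 := by rw [hβ]; field_simp
  have ht1 := mul_le_mul_of_nonneg_left (le_abs_self t) hβ0.le
  have ht2 := mul_le_mul_of_nonneg_left (neg_abs_le t) hβ0.le
  have e : midpoint ℝ A B + β • (C - A - t • (B - A)) =
      (1 / 2 - β + β * t) • A + (1 / 2 - β * t) • B + β • C := by
    rw [midpoint_eq_smul_add]; simp only [invOf_eq_inv]; module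
  rw [e]
  have hconv := convex_convexHull ℝ ({A, B, C} : Set E3)
  have hA : A ∈ convexHull ℝ ({A, B, C} : Set E3) := subset_convexHull ℝ _ (by simp)
  have hB : B ∈ convexHull ℝ ({A, B, C} : Set E3) := subset_convexHull ℝ _ (by simp)
  have hC : C ∈ convexHull ℝ ({A, B, C} : Set E3) := subset_convexHull ℝ _ (by simp)
  have := hconv.sum_mem (t := Finset.univ) (w := ![1 / 2 - β + β * t, 1 / 2 - β * t, β])
    (z := ![A, B, C]) ?_ ?_ ?_
  · simpa [Fin.sum_univ_three] using this
  · intro i _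
    fin_cases i
    · simp; nlinarith
    · simp; nlinarith
    · simpa using hβ0.le
  · simp [Fin.sum_univ_three]; ring
  · intro i _
    fin_cases i
    · simpa using hA
    · simpa using hB
    · simpa using hC

/-! ### Coordinates, regular polygons and the functionals maximal on them. -/

open ComplexConjugate

/-- The point of space with horizontal part `z` and height `t`. -/
noncomputable def pt (z : ℂ) (t : ℝ) : E3 := !₂[z.re, z.im, t]

@[simp] theorem pt_zero (z : ℂ) (t : ℝ) : pt z t 0 = z.re := rfl
@[simp] theorem pt_one (z : ℂ) (t : ℝ) : pt z t 1 = z.im := rfl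
@[simp] theorem pt_two (z : ℂ) (t : ℝ) : pt z t 2 = t := rfl

theorem pt_sub (z w : ℂ) (t s : ℝ) : pt z t - pt w s = pt (z - w) (t - s) := by
  ext i; fin_cases i <;> simp

theorem pt_add (z w : ℂ) (t s : ℝ) : pt z t + pt w s = pt (z + w) (t + s) := by
  ext i; fin_cases i <;> simp

theorem smul_pt (r : ℝ) (z : ℂ) (t : ℝ) : r • pt z t = pt (r * z) (r * t) := by
  ext i; fin_cases i <;> simp

theorem pt_eq_iff {z w : ℂ} {t s : ℝ} : pt z t = pt w s ↔ z = w ∧ t = s := by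
  constructor
  · intro h
    exact ⟨Complex.ext (congrArg (· 0) h) (congrArg (· 1) h), congrArg (· 2) h⟩
  · rintro ⟨rfl, rfl⟩; rfl

theorem pt_eq_zero_iff {z : ℂ} {t : ℝ} : pt z t = 0 ↔ z = 0 ∧ t = 0 := by
  have : (0 : E3) = pt 0 0 := by ext i; fin_cases i <;> simp
  rw [this, pt_eq_iff]

theorem eq_pt (u : E3) : u = pt ⟨u 0, u 1⟩ (u 2) := by
  ext i; fin_cases i <;> simp

theorem inner_pt (z w : ℂ) (t s : ℝ) :
    inner ℝ (pt z t) (pt w s) = z.re * w.re + z.im * w.im + t * s := by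
  simp [PiLp.inner_apply, Fin.sum_univ_three]; ring

theorem exists_functional_eq (l : StrongDual ℝ E3) :
    ∃ (w : ℂ) (γ : ℝ), ∀ z t, l (pt z t) = w.re * z.re + w.im * z.im + γ * t := by
  set u := (InnerProductSpace.toDual ℝ E3).symm l
  refine ⟨⟨u 0, u 1⟩, u 2, fun z t => ?_⟩
  rw [← inner_pt, ← eq_pt u, InnerProductSpace.toDual_symm_apply]

/-- The linear functional with gradient `pt w γ`. -/
noncomputable def functional (w : ℂ) (γ : ℝ) : StrongDual ℝ E3 := innerSL ℝ (pt w γ)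

theorem functional_pt (w z : ℂ) (γ t : ℝ) :
    functional w γ (pt z t) = w.re * z.re + w.im * z.im + γ * t := by
  rw [functional, innerSL_apply_apply, inner_pt]

/-- `U` is the vertex set of a regular polygon inscribed in the unit circle, and multiplication by
`η` moves each vertex to the next one. -/
structure RegularPolygon (U : Set ℂ) (η : ℂ) : Prop where
  finite : U.Finite
  nonempty : U.Nonempty
  norm_sq : ∀ z ∈ U, z.re ^ 2 + z.im ^ 2 = 1
  mul_mem : ∀ z ∈ U, z * η ∈ U
  mul_conj_mem : ∀ z ∈ U, z * conj η ∈ U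
  eta_sq : η.re ^ 2 + η.im ^ 2 = 1
  im_pos : 0 < η.im
  -- For `ξ = e^{iφ}` and `η = e^{iθ}`, the last alternative says `|cot (φ/2)| < cot (θ/2)`: the
  -- vertex is farther from `z` than its two neighbours.
  cases : ∀ z ∈ U, ∀ w ∈ U, ∃ ξ : ℂ, w = z * ξ ∧ (ξ = 1 ∨ ξ = η ∨ ξ = conj η ∨
    |ξ.im| * (1 - η.re) < (1 - ξ.re) * η.im)

/-- The vertex set of the pyramid. -/
def pyramidVertices (U : Set ℂ) (h : ℝ) : Set E3 := insert (pt 0 h) ((fun z => pt z 0) '' U)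

/-- The end points of the base edge starting at `z`. -/
def baseEdge (η z : ℂ) : Set E3 := {pt z 0, pt (z * η) 0}

/-- The end points of the lateral edge through `z`. -/
def lateralEdge (h : ℝ) (z : ℂ) : Set E3 := {pt z 0, pt 0 h}

/-- The vertices of the lateral facet over the base edge starting at `z`. -/
def lateralTriangle (η : ℂ) (h : ℝ) (z : ℂ) : Set E3 := {pt z 0, pt (z * η) 0, pt 0 h}

namespace RegularPolygon

variable {U : Set ℂ} {η : ℂ} {h : ℝ}

theorem re_lt_one (H : RegularPolygon U η) : η.re < 1 := by
  nlinarith [H.eta_sq, H.im_pos, pow_pos H.im_pos 2]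

theorem neg_one_lt_re (H : RegularPolygon U η) : -1 < η.re := by
  nlinarith [H.eta_sq, H.im_pos, pow_pos H.im_pos 2]

theorem mul_conj_mul (H : RegularPolygon U η) (z : ℂ) : z * conj η * η = z := by
  have : conj η * η = 1 := by
    rw [mul_comm, Complex.mul_conj, Complex.normSq_apply]
    have := H.eta_sq
    exact_mod_cast (by linarith : η.re * η.re + η.im * η.im = 1)
  rw [mul_assoc, this, mul_one]

theorem ne_zero (H : RegularPolygon U η) {z : ℂ} (hz : z ∈ U) : z ≠ 0 := by
  rintro rfl
  have := H.norm_sq 0 hz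
  simp at this

/-- Let `x` be the value at a maximal vertex `z` and `y` the value at `iz`. Comparison with the two
neighbours bounds `|y|` by a multiple of `x`, and the cotangent inequality in `RegularPolygon.cases`
then makes every vertex other than `z` and its neighbours strictly worse. Both neighbours cannot be
maximal at once, as their values add up to `2 x η.re < 2x`. -/
theorem argmax_cases (H : RegularPolygon U η) {w : ℂ} (hw : w ≠ 0) {M : ℝ}
    (hM : ∀ v ∈ U, w.re * v.re + w.im * v.im ≤ M) :
    {v ∈ U | w.re * v.re + w.im * v.im = M} = ∅ ∨
      ∃ z ∈ U, {v ∈ U | w.re * v.re + w.im * v.im = M} = {z} ∨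
        {v ∈ U | w.re * v.re + w.im * v.im = M} = {z, z * η} := by
  set B := {v ∈ U | w.re * v.re + w.im * v.im = M} with hB
  rcases B.eq_empty_or_nonempty with h0 | ⟨z, hz, hzM⟩
  · exact .inl h0
  right
  have hs := H.im_pos
  have hc := H.re_lt_one
  set x := w.re * z.re + w.im * z.im with hx
  set y := -w.re * z.im + w.im * z.re with hy
  have hval : ∀ ξ : ℂ, w.re * (z * ξ).re + w.im * (z * ξ).im = ξ.re * x + ξ.im * y := by
    intro ξ; rw [Complex.mul_re, Complex.mul_im, hx, hy]; ring
  have h1 := hM _ (H.mul_mem z hz)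
  have h2 := hM _ (H.mul_conj_mem z hz)
  rw [hval] at h1 h2
  rw [Complex.conj_re, Complex.conj_im] at h2
  have hxy : 0 < x ^ 2 + y ^ 2 := by
    have e : x ^ 2 + y ^ 2 = w.re ^ 2 + w.im ^ 2 := by
      rw [hx, hy]; linear_combination (w.re ^ 2 + w.im ^ 2) * H.norm_sq z hz
    rw [e]
    have := Complex.normSq_pos.2 hw
    rw [Complex.normSq_apply] at this
    linarith
  have hx0 : 0 < x := by
    have hx1 : 0 ≤ x := by
      have : 0 ≤ (1 - η.re) * x := by linarith
      exact nonneg_of_mul_nonneg_right this (by linarith)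
    refine hx1.lt_of_ne' ?_
    intro hx2
    have : η.im * y = 0 := by rw [← hzM, hx2] at h1 h2; linarith
    have hy0 := (mul_eq_zero.1 this).resolve_left hs.ne'
    rw [hx2, hy0] at hxy
    norm_num at hxy
  have hyabs : |y| * η.im ≤ (1 - η.re) * x := by
    have e : |y| * η.im = |y * η.im| := by rw [abs_mul, abs_of_pos hs]
    rw [e, abs_le]
    constructor <;> linarith
  have hmem : ∀ v ∈ B, v = z ∨ v = z * η ∨ v = z * conj η := by
    rintro v ⟨hv, hvM⟩
    obtain ⟨ξ, rfl, hξ⟩ := H.cases z hz v hv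
    rcases hξ with rfl | rfl | rfl | hξ
    · simp
    · simp
    · simp
    · exfalso
      rw [hval, ← hzM] at hvM
      have e1 : (1 - ξ.re) * η.im * x = ξ.im * y * η.im := by linear_combination -η.im * hvM
      have e2 : ξ.im * y * η.im ≤ |ξ.im| * (|y| * η.im) := by
        rw [← mul_assoc, ← abs_mul]
        exact mul_le_mul_of_nonneg_right (le_abs_self _) hs.le
      have e3 := mul_le_mul_of_nonneg_left hyabs (abs_nonneg ξ.im)
      have e4 := mul_lt_mul_of_pos_right hξ hx0
      linarith
  by_cases hp : z * η ∈ B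
  · refine ⟨z, hz, .inr ?_⟩
    have hn : z * conj η ∉ B := by
      rintro ⟨-, h3⟩
      have h4 := hp.2
      rw [hval] at h3 h4
      rw [Complex.conj_re, Complex.conj_im] at h3
      have : (1 - η.re) * x = 0 := by linarith
      exact (mul_pos (by linarith) hx0).ne' this
    ext v
    constructor
    · intro hv
      rcases hmem v hv with rfl | rfl | rfl
      · simp
      · simp
      · exact absurd hv hn
    · rintro (rfl | rfl)
      · exact ⟨hz, hzM⟩
      · exact hp
  by_cases hn : z * conj η ∈ B
  · refine ⟨z * conj η, hn.1, .inr ?_⟩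
    rw [H.mul_conj_mul]
    ext v
    constructor
    · intro hv
      rcases hmem v hv with rfl | rfl | rfl
      · simp
      · exact absurd hv hp
      · simp
    · rintro (rfl | rfl)
      · exact hn
      · exact ⟨hz, hzM⟩
  · refine ⟨z, hz, .inl ?_⟩
    ext v
    constructor
    · intro hv
      rcases hmem v hv with rfl | rfl | rfl
      · simp
      · exact absurd hv hp
      · exact absurd hv hn
    · rintro rfl
      exact ⟨hz, hzM⟩

/-- A functional is maximal on the pyramid at a maximal set of the base polygon, at the apex, or at
both. A zero horizontal gradient gives the whole base or none of it; otherwise `argmax_cases`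
applies. -/
theorem isArgmax_cases (H : RegularPolygon U η) {S : Set E3}
    (hS : IsArgmax (pyramidVertices U h) S) (hne : S.Nonempty) :
    S = pyramidVertices U h ∨ S = (fun z => pt z 0) '' U ∨ S = {pt 0 h} ∨
      ∃ z ∈ U, S = {pt z 0} ∨ S = baseEdge η z ∨ S = lateralEdge h z ∨ S = lateralTriangle η h z := by
  obtain ⟨l, M, hM, hS⟩ := hS
  obtain ⟨w, γ, hl⟩ := exists_functional_eq l
  set B := {v ∈ U | w.re * v.re + w.im * v.im = M} with hB
  have hMB : ∀ v ∈ U, w.re * v.re + w.im * v.im ≤ M := by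
    intro v hv
    have := hM (pt v 0) (Or.inr ⟨v, hv, rfl⟩)
    rw [hl] at this
    linarith
  have hMh : γ * h ≤ M := by
    have := hM (pt 0 h) (Or.inl rfl)
    rw [hl] at this
    simpa using this
  have hBcases : B = ∅ ∨ B = U ∨ ∃ z ∈ U, B = {z} ∨ B = {z, z * η} := by
    by_cases hw : w = 0
    · subst hw
      by_cases hM0 : M = 0
      · right; left
        ext v
        simp [hB, hM0]
      · left
        ext v
        simp [hB, Ne.symm hM0]
    · rcases H.argmax_cases hw hMB with h | h
      · exact .inl h
      · exact .inr (.inr h)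
  have hSB : (γ * h = M ∧ S = insert (pt 0 h) ((fun z => pt z 0) '' B)) ∨
      S = (fun z => pt z 0) '' B := by
    have himg : {v ∈ (fun z => pt z 0) '' U | l v = M} = (fun z => pt z 0) '' B := by
      ext v
      constructor
      · rintro ⟨⟨z, hz, rfl⟩, hv⟩
        refine ⟨z, ⟨hz, ?_⟩, rfl⟩
        rw [hl] at hv
        linarith
      · rintro ⟨z, ⟨hz, hzM⟩, rfl⟩
        refine ⟨⟨z, hz, rfl⟩, ?_⟩
        rw [hl]
        linarith
    have hlh : l (pt 0 h) = γ * h := by rw [hl]; simp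
    by_cases hγ : γ * h = M
    · left
      refine ⟨hγ, ?_⟩
      rw [hS, ← himg]
      ext v
      constructor
      · rintro ⟨rfl | hv, hv'⟩
        · exact .inl rfl
        · exact .inr ⟨hv, hv'⟩
      · rintro (rfl | ⟨hv, hv'⟩)
        · exact ⟨.inl rfl, by rw [hlh, hγ]⟩
        · exact ⟨.inr hv, hv'⟩
    · right
      rw [hS, ← himg]
      ext v
      constructor
      · rintro ⟨rfl | hv, hv'⟩
        · rw [hlh] at hv'; exact absurd hv' hγ
        · exact ⟨hv, hv'⟩
      · rintro ⟨hv, hv'⟩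
        exact ⟨.inr hv, hv'⟩
  rcases hBcases with hB | hB | ⟨z, hz, hB | hB⟩ <;> rw [hB] at hSB
  · rcases hSB with ⟨-, h⟩ | h
    · right; right; left; simpa using h
    · rw [h] at hne; simp at hne
  · rcases hSB with ⟨-, h⟩ | h
    · exact .inl h
    · exact .inr (.inl h)
  · right; right; right
    refine ⟨z, hz, ?_⟩
    rcases hSB with ⟨-, h⟩ | h
    · right; right; left; rw [h, Set.image_singleton]; exact Set.pair_comm _ _
    · left; rw [h, Set.image_singleton]
  · right; right; right
    refine ⟨z, hz, ?_⟩
    rcases hSB with ⟨-, h⟩ | h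
    · right; right; right
      rw [h, Set.image_pair, Set.insert_comm, lateralTriangle]
      congr 1
      exact Set.pair_comm _ _
    · right; left; rw [h, Set.image_pair]; rfl

end RegularPolygon

/-! ### Dimensions of the candidate faces. -/

theorem finrank_vectorSpan_pair {A B : E3} (hAB : A ≠ B) :
    Module.finrank ℝ (vectorSpan ℝ {A, B}) = 1 := by
  rw [vectorSpan_eq_span_vsub_set_right ℝ (Set.mem_insert A {B}), Set.image_pair, vsub_self,
    Submodule.span_insert_zero, finrank_span_singleton (vsub_ne_zero.2 hAB.symm)]

theorem finrank_vectorSpan_triple {A B C : E3} (h : LinearIndependent ℝ ![B - A, C - A]) :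
    Module.finrank ℝ (vectorSpan ℝ {A, B, C}) = 2 := by
  rw [vectorSpan_eq_span_vsub_set_right ℝ (Set.mem_insert A {B, C}), Set.image_insert_eq,
    Set.image_pair, vsub_self, Submodule.span_insert_zero, vsub_eq_sub, vsub_eq_sub]
  have := finrank_span_eq_card h
  rw [Matrix.range_cons, Matrix.range_cons, Matrix.range_empty,
    Set.union_empty, Set.singleton_union] at this
  simpa using this

/-- The horizontal embedding of the complex plane as a linear map. -/
noncomputable def horizontal : ℂ →ₗ[ℝ] E3 where
  toFun z := pt z 0
  map_add' z w := by rw [pt_add, add_zero]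
  map_smul' r z := by rw [RingHom.id_apply, smul_pt, mul_zero, Complex.real_smul]

namespace RegularPolygon

variable {U : Set ℂ} {η : ℂ} {h : ℝ}

theorem pt_mem_vectorSpan (H : RegularPolygon U η) (z : ℂ) :
    pt z 0 ∈ vectorSpan ℝ ((fun z => pt z 0) '' U) := by
  obtain ⟨u, hu⟩ := H.nonempty
  have hu0 := H.ne_zero hu
  have hs := H.im_pos
  have hc := H.re_lt_one
  have h1 := vsub_mem_vectorSpan ℝ (Set.mem_image_of_mem (fun z => pt z 0) (H.mul_mem u hu))
    (Set.mem_image_of_mem (fun z => pt z 0) hu)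
  have h2 := vsub_mem_vectorSpan ℝ (Set.mem_image_of_mem (fun z => pt z 0) (H.mul_conj_mem u hu))
    (Set.mem_image_of_mem (fun z => pt z 0) hu)
  simp only [vsub_eq_sub, pt_sub, sub_zero] at h1 h2
  set v := z / u with hv
  have hc' : η.re - 1 ≠ 0 := by linarith
  -- After division by `u`, these are the coordinates of `v` in the basis `η - 1`, `conj η - 1` of
  -- the plane.
  have key : pt z 0 = ((v.re / (η.re - 1) + v.im / η.im) / 2) • pt (u * η - u) 0 +
      ((v.re / (η.re - 1) - v.im / η.im) / 2) • pt (u * conj η - u) 0 := by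
    rw [smul_pt, smul_pt, pt_add, pt_eq_iff]
    refine ⟨?_, by simp⟩
    have hz : z = u * v := by rw [hv]; field_simp
    have : v = ((v.re / (η.re - 1) + v.im / η.im) / 2 : ℝ) * (η - 1) +
      ((v.re / (η.re - 1) - v.im / η.im) / 2 : ℝ) * (conj η - 1) := by
      apply Complex.ext
      · simp only [Complex.add_re, Complex.re_ofReal_mul, Complex.sub_re, Complex.one_re,
          Complex.conj_re]
        field_simp
        ring
      · simp only [Complex.add_im, Complex.im_ofReal_mul, Complex.sub_im, Complex.one_im,
          Complex.conj_im]
        field_simp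
        ring
    rw [hz]
    nth_rewrite 1 [this]
    ring
  rw [key]
  exact add_mem (Submodule.smul_mem _ _ h1) (Submodule.smul_mem _ _ h2)

theorem finrank_base (H : RegularPolygon U η) :
    Module.finrank ℝ (vectorSpan ℝ ((fun z => pt z 0) '' U)) = 2 := by
  have : vectorSpan ℝ ((fun z => pt z 0) '' U) = LinearMap.range horizontal := by
    apply le_antisymm
    · rw [vectorSpan, Submodule.span_le]
      rintro _ ⟨_, ⟨z, -, rfl⟩, _, ⟨w, -, rfl⟩, rfl⟩
      exact ⟨z - w, by simp [horizontal, pt_sub]⟩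
    · rintro _ ⟨z, rfl⟩
      exact H.pt_mem_vectorSpan z
  rw [this, LinearMap.finrank_range_of_inj, Complex.finrank_real_complex]
  intro z w hzw
  exact (pt_eq_iff.1 hzw).1

theorem finrank_pyramidVertices (H : RegularPolygon U η) (hh : h ≠ 0) :
    Module.finrank ℝ (vectorSpan ℝ (pyramidVertices U h)) = 3 := by
  have : vectorSpan ℝ (pyramidVertices U h) = ⊤ := by
    rw [eq_top_iff]
    rintro x -
    obtain ⟨u, hu⟩ := H.nonempty
    have hle : vectorSpan ℝ ((fun z => pt z 0) '' U) ≤ vectorSpan ℝ (pyramidVertices U h) :=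
      vectorSpan_mono ℝ (Set.subset_insert _ _)
    have h1 := vsub_mem_vectorSpan ℝ (Set.mem_insert (pt 0 h) ((fun z => pt z 0) '' U))
      (Set.mem_insert_of_mem (pt 0 h) (Set.mem_image_of_mem (fun z => pt z 0) hu))
    simp only [vsub_eq_sub, pt_sub, sub_zero, zero_sub] at h1
    have key : x = (x 2 / h) • pt (-u) h + pt (⟨x 0, x 1⟩ + (x 2 / h : ℝ) * u) 0 := by
      nth_rewrite 1 [eq_pt x]
      rw [smul_pt, pt_add, pt_eq_iff]
      constructor
      · ring
      · field_simp; ring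
    rw [key]
    exact add_mem (Submodule.smul_mem _ _ h1) (hle (H.pt_mem_vectorSpan _))
  rw [this, finrank_top]
  simp

theorem mul_eta_ne (H : RegularPolygon U η) {z : ℂ} (hz : z ∈ U) : z ≠ z * η := by
  intro h
  have : η = 1 := by
    have := mul_left_cancel₀ (H.ne_zero hz) ((mul_one z).trans h)
    exact this.symm
  have := congrArg Complex.im this
  simp [H.im_pos.ne'] at this

theorem mul_eta_ne_mul_conj (H : RegularPolygon U η) {z : ℂ} (hz : z ∈ U) :
    z * η ≠ z * conj η := by
  intro h
  have := congrArg Complex.im (mul_left_cancel₀ (H.ne_zero hz) h)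
  rw [Complex.conj_im] at this
  linarith [H.im_pos]

theorem finrank_lateralTriangle (H : RegularPolygon U η) (hh : h ≠ 0) {z : ℂ} (hz : z ∈ U) :
    Module.finrank ℝ (vectorSpan ℝ (lateralTriangle η h z)) = 2 := by
  apply finrank_vectorSpan_triple
  rw [LinearIndependent.pair_iff]
  intro s t hst
  rw [pt_sub, pt_sub, smul_pt, smul_pt, pt_add, pt_eq_zero_iff] at hst
  have ht : t = 0 := by
    have := hst.2
    simp only [sub_zero, mul_zero, zero_add] at this
    exact (mul_eq_zero.1 this).resolve_right hh
  refine ⟨?_, ht⟩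
  have h1 := hst.1
  rw [ht, Complex.ofReal_zero, zero_mul, add_zero] at h1
  rcases mul_eq_zero.1 h1 with h2 | h2
  · exact_mod_cast h2
  · exact absurd (sub_eq_zero.1 h2).symm (H.mul_eta_ne hz)

end RegularPolygon

/-! ### Edges and facets of the pyramid. -/

namespace RegularPolygon

variable {U : Set ℂ} {η : ℂ} {h : ℝ}

theorem isArgmax_base (hh : 0 < h) :
    IsArgmax (pyramidVertices U h) ((fun z => pt z 0) '' U) := by
  refine ⟨functional 0 (-1), 0, ?_, ?_⟩
  · rintro _ (rfl | ⟨z, -, rfl⟩)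
    · rw [functional_pt]; simp [hh.le]
    · simp [functional_pt]
  · ext v
    constructor
    · rintro ⟨z, hz, rfl⟩
      exact ⟨.inr ⟨z, hz, rfl⟩, by simp [functional_pt]⟩
    · rintro ⟨rfl | hv, hv'⟩
      · rw [functional_pt] at hv'; simp [hh.ne'] at hv'
      · exact hv

/-- `z (1 + η)` is the sum of the end points of a base edge, hence an outward normal to it. The same
normal cuts out the base edge and, once tilted, the lateral facet above it. -/
theorem inner_edge_normal (H : RegularPolygon U η) {z v : ℂ} (hz : z ∈ U) (hv : v ∈ U) :
    (z * (1 + η)).re * v.re + (z * (1 + η)).im * v.im ≤ 1 + η.re ∧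
      ((z * (1 + η)).re * v.re + (z * (1 + η)).im * v.im = 1 + η.re ↔ v = z ∨ v = z * η) := by
  obtain ⟨ξ, rfl, hξ⟩ := H.cases z hz v hv
  have hs := H.im_pos
  have hc := H.re_lt_one
  have hc' := H.neg_one_lt_re
  have hval : ∀ ξ : ℂ, (z * (1 + η)).re * (z * ξ).re + (z * (1 + η)).im * (z * ξ).im =
      (1 + η.re) * ξ.re + η.im * ξ.im := by
    intro ξ
    simp only [Complex.mul_re, Complex.mul_im, Complex.add_re, Complex.add_im, Complex.one_re,
      Complex.one_im]
    linear_combination ((1 + η.re) * ξ.re + η.im * ξ.im) * H.norm_sq z hz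
  have hv1 : (z * (1 + η)).re * z.re + (z * (1 + η)).im * z.im = 1 + η.re := by
    have := hval 1
    rw [mul_one] at this
    rw [this]; simp
  have hvη : (z * (1 + η)).re * (z * η).re + (z * (1 + η)).im * (z * η).im = 1 + η.re := by
    rw [hval]; linear_combination H.eta_sq
  suffices hsuff : (ξ = 1 ∨ ξ = η) ∨
      (z * (1 + η)).re * (z * ξ).re + (z * (1 + η)).im * (z * ξ).im < 1 + η.re by
    rcases hsuff with (rfl | rfl) | hlt
    · rw [mul_one]; exact ⟨hv1.le, fun _ => .inl rfl, fun _ => hv1⟩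
    · exact ⟨hvη.le, fun _ => .inr rfl, fun _ => hvη⟩
    · refine ⟨hlt.le, fun h => absurd h hlt.ne, ?_⟩
      rintro (h | h) <;> rw [h] at hlt ⊢
      · exact hv1
      · exact hvη
  rcases hξ with h | h | rfl | h
  · exact .inl (.inl h)
  · exact .inl (.inr h)
  · right
    rw [hval, Complex.conj_re, Complex.conj_im]
    nlinarith [H.eta_sq, pow_pos hs 2]
  · right
    rw [hval]
    have e1 := mul_lt_mul_of_pos_right h (by linarith : 0 < 1 + η.re)
    have e2 : η.im * (|ξ.im| * η.im) < η.im * ((1 - ξ.re) * (1 + η.re)) := by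
      have : |ξ.im| * (1 - η.re) * (1 + η.re) = η.im * (|ξ.im| * η.im) := by
        linear_combination (-|ξ.im|) * H.eta_sq
      rw [← this]
      linarith
    have e3 := lt_of_mul_lt_mul_left e2 hs.le
    have e4 := mul_le_mul_of_nonneg_right (le_abs_self ξ.im) hs.le
    linarith

theorem isArgmax_baseEdge (H : RegularPolygon U η) {z : ℂ} (hz : z ∈ U) :
    IsArgmax (pyramidVertices U h) (baseEdge η z) := by
  refine ⟨functional (z * (1 + η)) 0, 1 + η.re, ?_, ?_⟩
  · rintro _ (rfl | ⟨v, hv, rfl⟩)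
    · rw [functional_pt]
      have := H.neg_one_lt_re
      simp only [Complex.zero_re, Complex.zero_im]; linarith
    · rw [functional_pt]
      linarith [(H.inner_edge_normal hz hv).1]
  · ext v
    constructor
    · have h1 := (H.inner_edge_normal hz hz).2.2 (.inl rfl)
      have h2 := (H.inner_edge_normal hz (H.mul_mem z hz)).2.2 (.inr rfl)
      rintro (rfl | rfl)
      · exact ⟨.inr ⟨_, hz, rfl⟩, by rw [functional_pt]; linarith⟩
      · exact ⟨.inr ⟨_, H.mul_mem z hz, rfl⟩, by rw [functional_pt]; linarith⟩
    · rintro ⟨rfl | ⟨v, hv, rfl⟩, hv'⟩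
      · rw [functional_pt] at hv'
        have := H.neg_one_lt_re
        simp only [Complex.zero_re, Complex.zero_im] at hv'; linarith
      · rw [functional_pt] at hv'
        rcases (H.inner_edge_normal hz hv).2.1 (by linarith) with rfl | rfl
        · exact .inl rfl
        · exact .inr rfl

theorem isArgmax_lateralTriangle (H : RegularPolygon U η) (hh : 0 < h) {z : ℂ} (hz : z ∈ U) :
    IsArgmax (pyramidVertices U h) (lateralTriangle η h z) := by
  -- The vertical component is chosen so that the apex gets the same value as the base edge.
  have hap : functional (z * (1 + η)) ((1 + η.re) / h) (pt 0 h) = 1 + η.re := by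
    rw [functional_pt]; simp; field_simp
  refine ⟨functional (z * (1 + η)) ((1 + η.re) / h), 1 + η.re, ?_, ?_⟩
  · rintro _ (rfl | ⟨v, hv, rfl⟩)
    · exact hap.le
    · rw [functional_pt]
      linarith [(H.inner_edge_normal hz hv).1]
  · ext v
    constructor
    · have h1 := (H.inner_edge_normal hz hz).2.2 (.inl rfl)
      have h2 := (H.inner_edge_normal hz (H.mul_mem z hz)).2.2 (.inr rfl)
      rintro (rfl | rfl | rfl)
      · exact ⟨.inr ⟨_, hz, rfl⟩, by rw [functional_pt]; linarith⟩
      · exact ⟨.inr ⟨_, H.mul_mem z hz, rfl⟩, by rw [functional_pt]; linarith⟩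
      · exact ⟨.inl rfl, hap⟩
    · rintro ⟨rfl | ⟨v, hv, rfl⟩, hv'⟩
      · exact .inr (.inr rfl)
      · rw [functional_pt] at hv'
        rcases (H.inner_edge_normal hz hv).2.1 (by linarith) with rfl | rfl
        · exact .inl rfl
        · exact .inr (.inl rfl)

/-- With horizontal gradient `z`, Cauchy–Schwarz for unit vectors singles out `z` among the base
vertices; the vertical component `1/h` brings the apex to the same level. -/
theorem isArgmax_lateralEdge (H : RegularPolygon U η) (hh : 0 < h) {z : ℂ} (hz : z ∈ U) :
    IsArgmax (pyramidVertices U h) (lateralEdge h z) := by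
  have hap : functional z (1 / h) (pt 0 h) = 1 := by
    rw [functional_pt]; simp; field_simp
  have hz1 := H.norm_sq z hz
  refine ⟨functional z (1 / h), 1, ?_, ?_⟩
  · rintro _ (rfl | ⟨v, hv, rfl⟩)
    · exact hap.le
    · rw [functional_pt]
      nlinarith [H.norm_sq v hv, sq_nonneg (z.re - v.re), sq_nonneg (z.im - v.im)]
  · ext v
    constructor
    · rintro (rfl | rfl)
      · exact ⟨.inr ⟨_, hz, rfl⟩, by rw [functional_pt]; linarith⟩
      · exact ⟨.inl rfl, hap⟩
    · rintro ⟨rfl | ⟨v, hv, rfl⟩, hv'⟩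
      · exact .inr rfl
      · rw [functional_pt] at hv'
        have hv1 := H.norm_sq v hv
        have e : (z.re - v.re) ^ 2 + (z.im - v.im) ^ 2 = 0 := by
          linear_combination hz1 + hv1 - 2 * hv'
        have e1 : z.re - v.re = 0 := by
          nlinarith [sq_nonneg (z.re - v.re), sq_nonneg (z.im - v.im)]
        have e2 : z.im - v.im = 0 := by
          nlinarith [sq_nonneg (z.re - v.re), sq_nonneg (z.im - v.im)]
        left
        exact congrArg (fun z => pt z 0) (Complex.ext (by linarith) (by linarith))

theorem finrank_baseEdge (H : RegularPolygon U η) {z : ℂ} (hz : z ∈ U) :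
    Module.finrank ℝ (vectorSpan ℝ (baseEdge η z)) = 1 :=
  finrank_vectorSpan_pair fun h => H.mul_eta_ne hz (pt_eq_iff.1 h).1

theorem finrank_lateralEdge (hh : 0 < h) (z : ℂ) :
    Module.finrank ℝ (vectorSpan ℝ (lateralEdge h z)) = 1 :=
  finrank_vectorSpan_pair fun h => hh.ne (pt_eq_iff.1 h).2

theorem edges_eq (H : RegularPolygon U η) (hh : 0 < h) :
    edges (convexHull ℝ (pyramidVertices U h)) =
      (fun z => convexHull ℝ (baseEdge η z)) '' U ∪
        (fun z => convexHull ℝ (lateralEdge h z)) '' U := by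
  ext F
  rw [edges, mem_faces_convexHull_iff]
  constructor
  · rintro ⟨S, hne, hS, rfl, hk⟩
    rcases H.isArgmax_cases hS hne with rfl | rfl | rfl | ⟨z, hz, rfl | rfl | rfl | rfl⟩
    · rw [H.finrank_pyramidVertices hh.ne'] at hk; norm_num at hk
    · rw [H.finrank_base] at hk; norm_num at hk
    · rw [vectorSpan_singleton, finrank_bot] at hk; norm_num at hk
    · rw [vectorSpan_singleton, finrank_bot] at hk; norm_num at hk
    · exact .inl ⟨z, hz, rfl⟩
    · exact .inr ⟨z, hz, rfl⟩
    · rw [H.finrank_lateralTriangle hh.ne' hz] at hk; norm_num at hk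
  · rintro (⟨z, hz, rfl⟩ | ⟨z, hz, rfl⟩)
    · exact ⟨_, Set.insert_nonempty _ _, H.isArgmax_baseEdge hz, rfl, H.finrank_baseEdge hz⟩
    · exact ⟨_, Set.insert_nonempty _ _, H.isArgmax_lateralEdge hh hz, rfl, finrank_lateralEdge hh z⟩

theorem mem_facets_iff (H : RegularPolygon U η) (hh : 0 < h) {F : Set E3} :
    F ∈ facets (convexHull ℝ (pyramidVertices U h)) ↔
      F = convexHull ℝ ((fun z => pt z 0) '' U) ∨
        ∃ z ∈ U, F = convexHull ℝ (lateralTriangle η h z) := by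
  rw [facets, mem_faces_convexHull_iff]
  constructor
  · rintro ⟨S, hne, hS, rfl, hk⟩
    rcases H.isArgmax_cases hS hne with rfl | rfl | rfl | ⟨z, hz, rfl | rfl | rfl | rfl⟩
    · rw [H.finrank_pyramidVertices hh.ne'] at hk; norm_num at hk
    · exact .inl rfl
    · rw [vectorSpan_singleton, finrank_bot] at hk; norm_num at hk
    · rw [vectorSpan_singleton, finrank_bot] at hk; norm_num at hk
    · rw [H.finrank_baseEdge hz] at hk; norm_num at hk
    · rw [finrank_lateralEdge hh z] at hk; norm_num at hk
    · exact .inr ⟨z, hz, rfl⟩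
  · rintro (rfl | ⟨z, hz, rfl⟩)
    · exact ⟨_, H.nonempty.image _, isArgmax_base hh, rfl, H.finrank_base⟩
    · exact ⟨_, Set.insert_nonempty _ _, H.isArgmax_lateralTriangle hh hz, rfl,
        H.finrank_lateralTriangle hh.ne' hz⟩

theorem pt_mem_lateralTriangle {z v : ℂ} (hh : 0 < h) :
    pt v 0 ∈ lateralTriangle η h z ↔ v = z ∨ v = z * η := by
  simp [lateralTriangle, pt_eq_iff, hh.ne]

theorem eq_of_baseEdge_subset (H : RegularPolygon U η) {z w : ℂ} (hz : z ∈ U) (hw : w ∈ U)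
    (h1 : z = w ∨ z = w * η) (h2 : z * η = w ∨ z * η = w * η) : z = w := by
  have hη0 : η ≠ 0 := by rintro rfl; exact absurd H.im_pos (by simp)
  rcases h1 with h1 | rfl
  · exact h1
  rcases h2 with h2 | h2
  · have h3 : η * η = 1 := mul_left_cancel₀ (H.ne_zero hw) (by rw [← mul_assoc, h2, mul_one])
    have h4 : (η - 1) * (η + 1) = 0 := by linear_combination h3
    exfalso
    rcases mul_eq_zero.1 h4 with h5 | h5
    · have := congrArg Complex.im h5
      simp [H.im_pos.ne'] at this
    · have := congrArg Complex.im h5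
      simp [H.im_pos.ne'] at this
  · exact mul_right_cancel₀ hη0 h2

theorem baseEdge_injOn (H : RegularPolygon U η) :
    Set.InjOn (fun z => convexHull ℝ (baseEdge η z)) U := by
  intro z hz w hw hzw
  -- Base edges do not depend on the height, so any value serves here.
  have heq := ((H.isArgmax_baseEdge (h := 1) hz).convexHull_inj (H.isArgmax_baseEdge hw)).1 hzw
  have h1 : pt z 0 ∈ baseEdge η w := heq ▸ Set.mem_insert _ _
  have h2 : pt (z * η) 0 ∈ baseEdge η w := heq ▸ Set.mem_insert_of_mem _ rfl
  simp only [baseEdge, Set.mem_insert_iff, Set.mem_singleton_iff, pt_eq_iff, and_true] at h1 h2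
  exact H.eq_of_baseEdge_subset hz hw h1 h2

theorem lateralEdge_injOn (H : RegularPolygon U η) (hh : 0 < h) :
    Set.InjOn (fun z => convexHull ℝ (lateralEdge h z)) U := by
  intro z hz w hw hzw
  have heq := ((H.isArgmax_lateralEdge hh hz).convexHull_inj (H.isArgmax_lateralEdge hh hw)).1 hzw
  have h1 : pt z 0 ∈ lateralEdge h w := heq ▸ Set.mem_insert _ _
  simpa [lateralEdge, pt_eq_iff, hh.ne] using h1

theorem disjoint_edges (H : RegularPolygon U η) (hh : 0 < h) :
    Disjoint ((fun z => convexHull ℝ (baseEdge η z)) '' U)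
      ((fun z => convexHull ℝ (lateralEdge h z)) '' U) := by
  rw [Set.disjoint_left]
  rintro _ ⟨z, hz, rfl⟩ ⟨w, hw, hzw⟩
  have heq := ((H.isArgmax_lateralEdge hh hw).convexHull_inj (H.isArgmax_baseEdge hz)).1 hzw
  have h1 : pt 0 h ∈ baseEdge η z := heq ▸ Set.mem_insert_of_mem _ rfl
  simp [baseEdge, pt_eq_iff, hh.ne'] at h1

theorem base_mem_halfPlane (H : RegularPolygon U η) {z : ℂ} (hz : z ∈ U) {x : E3}
    (hx : x ∈ convexHull ℝ ((fun z => pt z 0) '' U)) :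
    ∃ α β : ℝ, 0 ≤ β ∧ x = midpoint ℝ (pt z 0) (pt (z * η) 0) +
      α • (pt (z * η) 0 - pt z 0) + β • pt (-(z * (1 + η) / 2)) 0 := by
  refine convexHull_min ?_ (convex_halfPlane _ _ _) hx
  rintro _ ⟨v, hv, rfl⟩
  have hle := (H.inner_edge_normal hz hv).1
  obtain ⟨ξ, rfl, -⟩ := H.cases z hz v hv
  have hval : (z * (1 + η)).re * (z * ξ).re + (z * (1 + η)).im * (z * ξ).im =
      (1 + η.re) * ξ.re + η.im * ξ.im := by
    simp only [Complex.mul_re, Complex.mul_im, Complex.add_re, Complex.add_im, Complex.one_re,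
      Complex.one_im]
    linear_combination ((1 + η.re) * ξ.re + η.im * ξ.im) * H.norm_sq z hz
  rw [hval] at hle
  have hc : 0 < 1 - η.re := by linarith [H.re_lt_one]
  have hc' : 0 < 1 + η.re := by linarith [H.neg_one_lt_re]
  set α := ((η.re - 1) * ξ.re + η.im * ξ.im) / (2 * (1 - η.re)) with hα
  set β := 1 - ((1 + η.re) * ξ.re + η.im * ξ.im) / (1 + η.re) with hβ
  refine ⟨α, β, ?_, ?_⟩
  · rw [hβ, sub_nonneg, div_le_one hc']; exact hle
  · rw [midpoint_eq_smul_add, pt_add, pt_sub, smul_pt, smul_pt, smul_pt, pt_add, pt_add, pt_eq_iff]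
    refine ⟨?_, by simp⟩
    have hξ : ξ = (1 + η) / 2 + α * (η - 1) - β * ((1 + η) / 2) := by
      apply Complex.ext
      · simp only [Complex.add_re, Complex.re_ofReal_mul, Complex.sub_re, Complex.one_re,
          Complex.div_ofNat_re]
        rw [hα, hβ]
        field_simp
        ring
      · simp only [Complex.add_im, Complex.im_ofReal_mul, Complex.sub_im, Complex.one_im,
          Complex.div_ofNat_im]
        rw [hα, hβ]
        field_simp
        linear_combination (-2 * ξ.im) * H.eta_sq
    nth_rewrite 1 [hξ]
    rw [invOf_eq_inv]
    push_cast
    ring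

theorem exists_mem_base (H : RegularPolygon U η) {z : ℂ} (hz : z ∈ U) :
    ∃ β : ℝ, 0 < β ∧ midpoint ℝ (pt z 0) (pt (z * η) 0) + β • pt (-(z * (1 + η) / 2)) 0 ∈
      convexHull ℝ ((fun z => pt z 0) '' U) := by
  -- This reaches the midpoint of the chord from the vertex before `z` to the vertex after `z * η`,
  -- which is parallel to the edge; for a triangle the chord is a single vertex.
  refine ⟨2 - 2 * η.re, by linarith [H.re_lt_one], ?_⟩
  have e : midpoint ℝ (pt z 0) (pt (z * η) 0) + (2 - 2 * η.re) • pt (-(z * (1 + η) / 2)) 0 =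
      midpoint ℝ (pt (z * conj η) 0) (pt (z * η * η) 0) := by
    rw [midpoint_eq_smul_add, midpoint_eq_smul_add, pt_add, smul_pt, smul_pt, pt_add, pt_add, smul_pt,
      pt_eq_iff]
    refine ⟨?_, by simp⟩
    have h1 : ((η.re : ℝ) : ℂ) * 2 = η + conj η := by
      rw [Complex.add_conj]; push_cast; ring
    have h2 : conj η * η = 1 := by
      apply mul_left_cancel₀ (H.ne_zero hz)
      rw [← mul_assoc, H.mul_conj_mul, mul_one]
    rw [invOf_eq_inv]
    push_cast
    linear_combination z * (1 + η) / 2 * h1 + z / 2 * h2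
  rw [e]
  exact (convex_convexHull ℝ _).midpoint_mem
    (subset_convexHull ℝ _ ⟨_, H.mul_conj_mem z hz, rfl⟩)
    (subset_convexHull ℝ _ ⟨_, H.mul_mem _ (H.mul_mem z hz), rfl⟩)

end RegularPolygon

/-! ### Edge lengths, dihedral angles and the Dehn invariant of a pyramid. -/

/-- The dihedral angle at the base edges of a right pyramid of height `h` over a regular polygon
inscribed in the unit circle, with central angle of cosine `c`. -/
noncomputable def baseAngle (c h : ℝ) : ℝ := Real.arccos (√((1 + c) / 2 / ((1 + c) / 2 + h ^ 2)))

/-- The dihedral angle at the lateral edges of a right pyramid of height `h` over a regular polygon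
inscribed in the unit circle, with central angle of cosine `c`. -/
noncomputable def lateralAngle (c h : ℝ) : ℝ :=
  Real.arccos (-(2 * c * h ^ 2 + 1 + c) / (1 + c + 2 * h ^ 2))

theorem pyramidAngles_baseAngle_lateralAngle {c h : ℝ} (hc : -1 < c) (hc' : c < 1) (hh : 0 < h) :
    PyramidAngles c h (baseAngle c h) (lateralAngle c h) := by
  have hM : 0 < (1 + c) / 2 := by linarith
  have hh2 : 0 < h ^ 2 := by positivity
  have hpos : 0 < (1 + c) / 2 / ((1 + c) / 2 + h ^ 2) := by positivity
  have hlt : (1 + c) / 2 / ((1 + c) / 2 + h ^ 2) < 1 := by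
    rw [div_lt_one (by positivity)]; linarith
  have hs1 : √((1 + c) / 2 / ((1 + c) / 2 + h ^ 2)) < 1 := by
    rw [Real.sqrt_lt' one_pos]; linarith
  have hs0 := Real.sqrt_pos.2 hpos
  have hden : 0 < 1 + c + 2 * h ^ 2 := by linarith
  refine ⟨hc, hc', hh, Real.arccos_pos.2 hs1, Real.arccos_lt_pi_div_two.2 hs0,
    Real.arccos_nonneg _, Real.arccos_le_pi _, ?_, ?_⟩
  · rw [Real.cos_two_mul, baseAngle, Real.cos_arccos (by linarith) hs1.le, Real.sq_sqrt hpos.le]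
    field_simp
    ring
  · rw [lateralAngle, Real.cos_arccos]
    · rw [le_div_iff₀ hden]; nlinarith
    · rw [div_le_one hden]; nlinarith

namespace RegularPolygon

variable {U : Set ℂ} {η : ℂ} {h : ℝ}

theorem diam_baseEdge (H : RegularPolygon U η) {z : ℂ} (hz : z ∈ U) :
    Metric.diam (convexHull ℝ (baseEdge η z)) = √(2 - 2 * η.re) := by
  rw [convexHull_diam, baseEdge, Metric.diam_pair, EuclideanSpace.dist_eq]
  congr 1
  simp only [Fin.sum_univ_three, Real.dist_eq, sq_abs, pt_zero, pt_one, pt_two, Complex.mul_re,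
    Complex.mul_im]
  linear_combination (1 - 2 * η.re + η.re ^ 2 + η.im ^ 2) * H.norm_sq z hz + H.eta_sq

theorem diam_lateralEdge (H : RegularPolygon U η) {z : ℂ} (hz : z ∈ U) :
    Metric.diam (convexHull ℝ (lateralEdge h z)) = √(1 + h ^ 2) := by
  rw [convexHull_diam, lateralEdge, Metric.diam_pair, EuclideanSpace.dist_eq]
  congr 1
  simp only [Fin.sum_univ_three, Real.dist_eq, sq_abs, pt_zero, pt_one, pt_two, Complex.zero_re,
    Complex.zero_im]
  linear_combination H.norm_sq z hz

theorem dihedralAngle_baseEdge (H : RegularPolygon U η) (hh : 0 < h) {z : ℂ} (hz : z ∈ U) :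
    dihedralAngle (convexHull ℝ (pyramidVertices U h)) (convexHull ℝ (baseEdge η z)) =
      baseAngle η.re h := by
  have hz1 := H.norm_sq z hz
  have hc := H.neg_one_lt_re
  have hM : 0 < (1 + η.re) / 2 := by linarith
  -- The apex projects orthogonally to the midpoint of the base edge, hence the factor `1/2`.
  set f := pt 0 h - pt z 0 - (1 / 2 : ℝ) • (pt (z * η) 0 - pt z 0) with hf
  have hf' : f = pt (-(z * (1 + η) / 2)) h := by
    rw [hf, pt_sub, pt_sub, smul_pt, pt_sub, pt_eq_iff]
    refine ⟨?_, by ring⟩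
    push_cast
    ring
  set g := pt (-(z * (1 + η) / 2)) 0 with hg
  have hff : ∀ t s : ℝ, inner ℝ (pt (-(z * (1 + η) / 2)) t) (pt (-(z * (1 + η) / 2)) s) =
      (1 + η.re) / 2 + t * s := by
    intro t s
    rw [inner_pt]
    simp only [Complex.neg_re, Complex.neg_im, Complex.div_ofNat_re, Complex.div_ofNat_im,
      Complex.mul_re, Complex.mul_im, Complex.add_re, Complex.add_im, Complex.one_re, Complex.one_im]
    linear_combination (1 + 2 * η.re + η.re ^ 2 + η.im ^ 2) / 4 * hz1 + H.eta_sq / 4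
  have hfd : ∀ t : ℝ, inner ℝ (pt (-(z * (1 + η) / 2)) t) (pt (z * η) 0 - pt z 0) = 0 := by
    intro t
    rw [pt_sub, inner_pt]
    simp only [Complex.neg_re, Complex.neg_im, Complex.div_ofNat_re, Complex.div_ofNat_im,
      Complex.mul_re, Complex.mul_im, Complex.add_re, Complex.add_im, Complex.one_re, Complex.one_im,
      Complex.sub_re, Complex.sub_im]
    linear_combination (-(z.re ^ 2 + z.im ^ 2) / 2) * H.eta_sq
  have hnf : ‖f‖ = √((1 + η.re) / 2 + h ^ 2) := by
    rw [norm_eq_sqrt_real_inner, hf', hff, sq]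
  have hng : ‖g‖ = √((1 + η.re) / 2) := by
    rw [norm_eq_sqrt_real_inner, hg, hff, mul_zero, add_zero]
  have hf0 : f ≠ 0 := by rw [← norm_ne_zero_iff, hnf]; positivity
  have hg0 : g ≠ 0 := by rw [← norm_ne_zero_iff, hng]; positivity
  have hd0 : pt (z * η) 0 - pt z 0 ≠ 0 :=
    sub_ne_zero.2 fun h => H.mul_eta_ne hz (pt_eq_iff.1 h).1.symm
  have htri := H.isArgmax_lateralTriangle hh hz
  have hbase := isArgmax_base (U := U) hh
  have hedge := H.isArgmax_baseEdge (h := h) hz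
  rw [dihedralAngle_eq_angle (F := convexHull ℝ (lateralTriangle η h z))
    (G := convexHull ℝ ((fun z => pt z 0) '' U)) (m := midpoint ℝ (pt z 0) (pt (z * η) 0))
    (d := pt (z * η) 0 - pt z 0) (f := f) (g := g)]
  · rw [InnerProductGeometry.angle, baseAngle, hnf, hng, hf', hg, hff, mul_zero, add_zero]
    congr 1
    rw [Real.sqrt_div hM.le, mul_comm, ← div_div]
    congr 1
    nth_rewrite 1 [← Real.mul_self_sqrt hM.le]
    field_simp
  · rw [H.edges_eq hh]; exact .inl ⟨z, hz, rfl⟩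
  · exact (H.mem_facets_iff hh).2 (.inr ⟨z, hz, rfl⟩)
  · exact (H.mem_facets_iff hh).2 (.inl rfl)
  · rw [htri.convexHull_inter hbase]
    congr 1
    ext v
    constructor
    · rintro ⟨rfl | rfl | rfl, hv⟩
      · exact .inl rfl
      · exact .inr rfl
      · obtain ⟨w, -, hw⟩ := hv
        exact absurd (pt_eq_iff.1 hw).2 hh.ne
    · rintro (rfl | rfl)
      · exact ⟨.inl rfl, z, hz, rfl⟩
      · exact ⟨.inr (.inl rfl), z * η, H.mul_mem z hz, rfl⟩
  · intro K hK heK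
    rcases (H.mem_facets_iff hh).1 hK with rfl | ⟨w, hw, rfl⟩
    · exact .inr rfl
    · left
      rw [hedge.convexHull_subset_iff (H.isArgmax_lateralTriangle hh hw)] at heK
      have h1 := (pt_mem_lateralTriangle hh).1 (heK (.inl rfl))
      have h2 := (pt_mem_lateralTriangle hh).1 (heK (.inr rfl))
      rw [H.eq_of_baseEdge_subset hz hw h1 h2]
  · exact midpoint_mem_segment_hull _ _
  · exact exists_midpoint_add_mem_segment _ _
  · exact fun x hx => segment_mem_line _ _ hx
  · exact hd0
  · rw [hf']; exact hfd h
  · exact hfd 0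
  · exact fun x hx => triangle_mem_halfPlane _ _ _ _ hx
  · exact fun x hx => H.base_mem_halfPlane hz hx
  · exact hf0
  · exact hg0
  · exact exists_midpoint_add_mem_triangle _ _ _ _
  · exact H.exists_mem_base hz

theorem dihedralAngle_lateralEdge (H : RegularPolygon U η) (hh : 0 < h) {z : ℂ} (hz : z ∈ U) :
    dihedralAngle (convexHull ℝ (pyramidVertices U h)) (convexHull ℝ (lateralEdge h z)) =
      lateralAngle η.re h := by
  have hz1 := H.norm_sq z hz
  have hc := H.neg_one_lt_re
  have hc' := H.re_lt_one
  have hh2 : 0 < 1 + h ^ 2 := by positivity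
  -- The foot of the perpendicular from either neighbour of `z` to the lateral edge is at the
  -- fraction `t` of the way from `z` to the apex.
  set t := (1 - η.re) / (1 + h ^ 2) with ht
  have hth : t * (1 + h ^ 2) = 1 - η.re := by rw [ht]; field_simp
  set f := pt (z * η) 0 - pt z 0 - t • (pt 0 h - pt z 0) with hf
  set g := pt (z * conj η) 0 - pt z 0 - t • (pt 0 h - pt z 0) with hg
  have hf' : f = pt (z * (η - 1 + t)) (-(t * h)) := by
    rw [hf, pt_sub, pt_sub, smul_pt, pt_sub, pt_eq_iff]
    constructor <;> ring
  have hg' : g = pt (z * (conj η - 1 + t)) (-(t * h)) := by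
    rw [hg, pt_sub, pt_sub, smul_pt, pt_sub, pt_eq_iff]
    constructor <;> ring
  have hin : ∀ u v : ℂ, inner ℝ (pt (z * u) (-(t * h))) (pt (z * v) (-(t * h))) =
      u.re * v.re + u.im * v.im + t ^ 2 * h ^ 2 := by
    intro u v
    rw [inner_pt, Complex.mul_re, Complex.mul_re, Complex.mul_im, Complex.mul_im]
    linear_combination (u.re * v.re + u.im * v.im) * hz1
  have hfd : ∀ u : ℂ, u.re = η.re →
      inner ℝ (pt (z * (u - 1 + t)) (-(t * h))) (pt 0 h - pt z 0) = 0 := by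
    intro u hu
    rw [pt_sub, inner_pt]
    simp only [Complex.mul_re, Complex.mul_im, Complex.add_re, Complex.add_im, Complex.one_re,
      Complex.one_im, Complex.sub_re, Complex.sub_im, Complex.ofReal_re, Complex.ofReal_im,
      Complex.zero_re, Complex.zero_im, hu]
    linear_combination (-(η.re - 1 + t)) * hz1 - hth
  have hff : inner ℝ f f = (1 - η.re) * (2 - t) := by
    rw [hf', hin]
    simp only [Complex.add_re, Complex.add_im, Complex.one_re, Complex.one_im, Complex.sub_re,
      Complex.sub_im, Complex.ofReal_re, Complex.ofReal_im]
    linear_combination H.eta_sq + t * hth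
  have hgg : inner ℝ g g = (1 - η.re) * (2 - t) := by
    rw [hg', hin]
    simp only [Complex.add_re, Complex.add_im, Complex.one_re, Complex.one_im, Complex.sub_re,
      Complex.sub_im, Complex.ofReal_re, Complex.ofReal_im, Complex.conj_re, Complex.conj_im]
    linear_combination H.eta_sq + t * hth
  have hfg : inner ℝ f g = (1 - η.re) * (-2 * η.re - t) := by
    rw [hf', hg', hin]
    simp only [Complex.add_re, Complex.add_im, Complex.one_re, Complex.one_im, Complex.sub_re,
      Complex.sub_im, Complex.ofReal_re, Complex.ofReal_im, Complex.conj_re, Complex.conj_im]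
    linear_combination -H.eta_sq + t * hth
  have ht2 : 0 < 2 - t := by
    rw [ht, sub_pos, div_lt_iff₀ hh2]
    nlinarith [sq_nonneg h]
  have h1c : 0 < 1 - η.re := by linarith
  have hpos : 0 < (1 - η.re) * (2 - t) := mul_pos h1c ht2
  have hnf : ‖f‖ = √((1 - η.re) * (2 - t)) := by rw [norm_eq_sqrt_real_inner, hff]
  have hng : ‖g‖ = √((1 - η.re) * (2 - t)) := by rw [norm_eq_sqrt_real_inner, hgg]
  have hf0 : f ≠ 0 := by rw [← norm_ne_zero_iff, hnf]; positivity
  have hg0 : g ≠ 0 := by rw [← norm_ne_zero_iff, hng]; positivity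
  have hd0 : pt 0 h - pt z 0 ≠ 0 := sub_ne_zero.2 fun e => hh.ne' (pt_eq_iff.1 e).2
  have hz' := H.mul_conj_mem z hz
  have hset₁ : lateralTriangle η h z = {pt z 0, pt 0 h, pt (z * η) 0} := by
    rw [lateralTriangle, Set.pair_comm (pt (z * η) 0)]
  have hset₂ : lateralTriangle η h (z * conj η) = {pt z 0, pt 0 h, pt (z * conj η) 0} := by
    rw [lateralTriangle, H.mul_conj_mul, Set.insert_comm, Set.pair_comm (pt (z * conj η) 0)]
  have htri₁ := H.isArgmax_lateralTriangle hh hz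
  have htri₂ := H.isArgmax_lateralTriangle hh hz'
  have hedge := H.isArgmax_lateralEdge hh hz
  have hη0 : η ≠ 0 := by rintro rfl; exact absurd H.im_pos (by simp)
  rw [dihedralAngle_eq_angle (F := convexHull ℝ (lateralTriangle η h z))
    (G := convexHull ℝ (lateralTriangle η h (z * conj η))) (m := midpoint ℝ (pt z 0) (pt 0 h))
    (d := pt 0 h - pt z 0) (f := f) (g := g)]
  · rw [InnerProductGeometry.angle, lateralAngle, hnf, hng, hfg, Real.mul_self_sqrt hpos.le,
      mul_div_mul_left _ _ h1c.ne']
    congr 1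
    have hden : 0 < 1 + η.re + 2 * h ^ 2 := by nlinarith [sq_nonneg h]
    rw [div_eq_div_iff ht2.ne' hden.ne']
    linear_combination (-2 * (1 + η.re)) * hth
  · rw [H.edges_eq hh]; exact .inr ⟨z, hz, rfl⟩
  · exact (H.mem_facets_iff hh).2 (.inr ⟨z, hz, rfl⟩)
  · exact (H.mem_facets_iff hh).2 (.inr ⟨_, hz', rfl⟩)
  · rw [htri₁.convexHull_inter htri₂, hset₁, hset₂]
    congr 1
    ext v
    constructor
    · rintro ⟨rfl | rfl | rfl, hv⟩
      · exact .inl rfl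
      · exact .inr rfl
      · rcases hv with hv | hv | hv
        · exact absurd (pt_eq_iff.1 hv).1.symm (H.mul_eta_ne hz)
        · exact absurd (pt_eq_iff.1 hv).2 hh.ne
        · exact absurd (pt_eq_iff.1 hv).1 (H.mul_eta_ne_mul_conj hz)
    · rintro (rfl | rfl)
      · exact ⟨.inl rfl, .inl rfl⟩
      · exact ⟨.inr (.inl rfl), .inr (.inl rfl)⟩
  · intro K hK heK
    rcases (H.mem_facets_iff hh).1 hK with rfl | ⟨w, hw, rfl⟩
    · rw [hedge.convexHull_subset_iff (isArgmax_base hh)] at heK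
      obtain ⟨w, -, hw⟩ := heK (.inr rfl)
      exact absurd (pt_eq_iff.1 hw).2 hh.ne
    · rw [hedge.convexHull_subset_iff (H.isArgmax_lateralTriangle hh hw)] at heK
      rcases (pt_mem_lateralTriangle hh).1 (heK (.inl rfl)) with rfl | h1
      · exact .inl rfl
      · right
        have : w = z * conj η := mul_right_cancel₀ hη0 (by rw [← h1, H.mul_conj_mul])
        rw [this]
  · exact midpoint_mem_segment_hull _ _
  · exact exists_midpoint_add_mem_segment _ _
  · exact fun x hx => segment_mem_line _ _ hx
  · exact hd0
  · rw [hf']; exact hfd η rfl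
  · rw [hg']; exact hfd _ (Complex.conj_re η)
  · rw [hset₁]; exact fun x hx => triangle_mem_halfPlane _ _ _ _ hx
  · rw [hset₂]; exact fun x hx => triangle_mem_halfPlane _ _ _ _ hx
  · exact hf0
  · exact hg0
  · rw [hset₁]; exact exists_midpoint_add_mem_triangle _ _ _ _
  · rw [hset₂]; exact exists_midpoint_add_mem_triangle _ _ _ _

theorem dehnInvariant_eq (H : RegularPolygon U η) (hh : 0 < h) :
    dehnInvariant (convexHull ℝ (pyramidVertices U h)) =
      U.ncard • (√(2 - 2 * η.re) ⊗ₜ[ℤ] ((baseAngle η.re h : ℝ) : AddCircle Real.pi) +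
        √(1 + h ^ 2) ⊗ₜ[ℤ] ((lateralAngle η.re h : ℝ) : AddCircle Real.pi)) := by
  have hconst : ∀ a : ℝ ⊗[ℤ] AddCircle Real.pi, ∑ᶠ z ∈ U, a = U.ncard • a := by
    intro a
    rw [finsum_mem_eq_finite_toFinset_sum _ H.finite, Finset.sum_const,
      Set.ncard_eq_toFinset_card _ H.finite]
  rw [dehnInvariant, H.edges_eq hh, finsum_mem_union (H.disjoint_edges hh) (H.finite.image _)
    (H.finite.image _), finsum_mem_image H.baseEdge_injOn, finsum_mem_image (H.lateralEdge_injOn hh),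
    smul_add, ← hconst, ← hconst]
  congr 1
  · refine finsum_mem_congr rfl fun z hz => ?_
    rw [H.diam_baseEdge hz, H.dihedralAngle_baseEdge hh hz]
  · refine finsum_mem_congr rfl fun z hz => ?_
    rw [H.diam_lateralEdge hz, H.dihedralAngle_lateralEdge hh hz]

theorem isRationalPolytope_iff (H : RegularPolygon U η) (hh : 0 < h) :
    IsRationalPolytope (convexHull ℝ (pyramidVertices U h)) ↔
      baseAngle η.re h ∈ ratPi ∧ lateralAngle η.re h ∈ ratPi := by
  rw [IsRationalPolytope, H.edges_eq hh]
  constructor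
  · intro hP
    obtain ⟨z, hz⟩ := H.nonempty
    constructor
    · rw [mem_ratPi, ← H.dihedralAngle_baseEdge hh hz]
      exact hP _ (.inl ⟨z, hz, rfl⟩)
    · rw [mem_ratPi, ← H.dihedralAngle_lateralEdge hh hz]
      exact hP _ (.inr ⟨z, hz, rfl⟩)
  · rintro ⟨h1, h2⟩ _ (⟨z, hz, rfl⟩ | ⟨z, hz, rfl⟩)
    · beta_reduce
      rw [H.dihedralAngle_baseEdge hh hz]
      exact mem_ratPi.1 h1
    · beta_reduce
      rw [H.dihedralAngle_lateralEdge hh hz]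
      exact mem_ratPi.1 h2

end RegularPolygon

/-! ### The roots of unity as a regular polygon. -/

/-- In half-angles this is `|cot φ| < cot ψ`, which amounts to the positivity of `sin (φ - ψ)` and
`sin (φ + ψ)`. -/
theorem abs_sin_two_mul_mul_lt {φ ψ : ℝ} (hψ : 0 < ψ) (hφψ : ψ < φ) (hsum : φ + ψ < Real.pi) :
    |Real.sin (2 * φ)| * (1 - Real.cos (2 * ψ)) < (1 - Real.cos (2 * φ)) * Real.sin (2 * ψ) := by
  have h1 : 0 < Real.sin φ := Real.sin_pos_of_pos_of_lt_pi (by linarith) (by linarith)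
  have h2 : 0 < Real.sin ψ := Real.sin_pos_of_pos_of_lt_pi hψ (by linarith)
  have h3 : 0 < Real.sin (φ - ψ) := Real.sin_pos_of_pos_of_lt_pi (by linarith) (by linarith)
  have h4 : 0 < Real.sin (φ + ψ) := Real.sin_pos_of_pos_of_lt_pi (by linarith) (by linarith)
  rw [Real.sin_sub] at h3
  rw [Real.sin_add] at h4
  have h5 : |Real.cos φ * Real.sin ψ| < Real.sin φ * Real.cos ψ := by
    rw [abs_lt]; constructor <;> linarith
  rw [abs_mul, abs_of_pos h2] at h5
  have h6 : |Real.sin (2 * φ)| = 2 * Real.sin φ * |Real.cos φ| := by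
    rw [Real.sin_two_mul, abs_mul, abs_of_pos (by positivity : 0 < 2 * Real.sin φ)]
  have e1 : 1 - Real.cos (2 * φ) = 2 * Real.sin φ ^ 2 := by
    rw [Real.cos_two_mul, Real.sin_sq]; ring
  have e2 : 1 - Real.cos (2 * ψ) = 2 * Real.sin ψ ^ 2 := by
    rw [Real.cos_two_mul, Real.sin_sq]; ring
  rw [h6, e1, e2, Real.sin_two_mul]
  have := mul_lt_mul_of_pos_left h5 (by positivity : 0 < 4 * Real.sin φ * Real.sin ψ)
  linarith

theorem regularPolygon_rootsOfUnity {n : ℕ} (hn : 3 ≤ n) :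
    RegularPolygon {z : ℂ | z ^ n = 1} (Complex.exp ((2 * Real.pi / n : ℝ) * Complex.I)) := by
  set θ : ℝ := 2 * Real.pi / n with hθ
  set η := Complex.exp (θ * Complex.I) with hη
  have hn0 : n ≠ 0 := by omega
  have hn0' : (n : ℝ) ≠ 0 := by exact_mod_cast hn0
  have hn0'' : (n : ℂ) ≠ 0 := by exact_mod_cast hn0
  have hn3 : (3 : ℝ) ≤ n := by exact_mod_cast hn
  have hprim : IsPrimitiveRoot η n := by
    have := Complex.isPrimitiveRoot_exp n hn0
    convert this using 2
    rw [hθ]; push_cast; ring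
  have hre : ∀ k : ℕ, (η ^ k).re = Real.cos (k * θ) := by
    intro k
    rw [hη, ← Complex.exp_nat_mul, ← Complex.exp_ofReal_mul_I_re]
    push_cast; ring_nf
  have him : ∀ k : ℕ, (η ^ k).im = Real.sin (k * θ) := by
    intro k
    rw [hη, ← Complex.exp_nat_mul, ← Complex.exp_ofReal_mul_I_im]
    push_cast; ring_nf
  have hre1 : η.re = Real.cos θ := by simpa using hre 1
  have him1 : η.im = Real.sin θ := by simpa using him 1
  have hθ0 : 0 < θ := by rw [hθ]; positivity
  have hθπ : θ < Real.pi := by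
    rw [hθ, div_lt_iff₀ (by positivity)]
    nlinarith [Real.pi_pos]
  have hηc : conj η * η = 1 := by
    rw [mul_comm, Complex.mul_conj, Complex.normSq_apply, hre1, him1, ← sq, ← sq, Real.cos_sq_add_sin_sq,
      Complex.ofReal_one]
  refine ⟨?_, ⟨1, by simp⟩, ?_, ?_, ?_, ?_, ?_, ?_⟩
  · have : {z : ℂ | z ^ n = 1} = ↑(Polynomial.nthRootsFinset n (1 : ℂ)) := by
      ext z; simp [Polynomial.mem_nthRootsFinset (by omega : 0 < n)]
    rw [this]
    exact Finset.finite_toSet _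
  · intro z hz
    have := Complex.norm_eq_one_of_pow_eq_one hz hn0
    have h2 := Complex.sq_norm z
    rw [this, Complex.normSq_apply] at h2
    linarith
  · intro z hz
    rw [Set.mem_ofPred_eq] at hz ⊢
    rw [mul_pow, hz, hprim.pow_eq_one, one_mul]
  · intro z hz
    rw [Set.mem_ofPred_eq] at hz ⊢
    rw [mul_pow, hz, ← map_pow, hprim.pow_eq_one, map_one, one_mul]
  · rw [hre1, him1, Real.cos_sq_add_sin_sq]
  · rw [him1]; exact Real.sin_pos_of_pos_of_lt_pi hθ0 hθπ
  · intro z hz w hw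
    rw [Set.mem_ofPred_eq] at hz hw
    have hz0 : z ≠ 0 := by rintro rfl; rw [zero_pow hn0] at hz; exact zero_ne_one hz
    have hn' : NeZero n := ⟨hn0⟩
    obtain ⟨k, hk, hkξ⟩ := hprim.eq_pow_of_pow_eq_one (ξ := w / z)
      (by rw [div_pow, hz, hw, div_one])
    refine ⟨w / z, by field_simp, ?_⟩
    rw [← hkξ]
    rcases Nat.eq_zero_or_pos k with rfl | hk0
    · left; simp
    rcases Nat.eq_or_lt_of_le hk0 with rfl | hk1
    · right; left; simp
    rcases Nat.eq_or_lt_of_le hk with hk2 | hk2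
    · right; right; left
      have hη0 : η ≠ 0 := Complex.exp_ne_zero _
      apply mul_right_cancel₀ hη0
      rw [hηc, ← pow_succ, ← hprim.pow_eq_one, ← hk2]
    · right; right; right
      rw [hre, him, hre1, him1]
      have hk1' : (2 : ℝ) ≤ k := by exact_mod_cast hk1
      have hk2' : (k : ℝ) + 2 ≤ n := by exact_mod_cast hk2
      have hnθ : n * θ = 2 * Real.pi := by rw [hθ]; field_simp
      have := abs_sin_two_mul_mul_lt (φ := k * θ / 2) (ψ := θ / 2) (by linarith)
        (by nlinarith) (by nlinarith)
      rwa [mul_div_cancel₀ _ two_ne_zero, mul_div_cancel₀ _ two_ne_zero] at this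

/-! ### The Dehn invariants for `n = 3, 4, 6`. -/

theorem pyramid_eq (n : ℕ) (h : ℝ) :
    pyramid n h = convexHull ℝ (pyramidVertices {z : ℂ | z ^ n = 1} h) := rfl

theorem exists_dehnInvariant_pyramid_eq {n : ℕ} (hn : 3 ≤ n) {h : ℝ} (hh : 0 < h) {c : ℝ}
    (hc : Real.cos (2 * Real.pi / n) = c) :
    ∃ N : ℕ, N ≠ 0 ∧ dehnInvariant (pyramid n h) =
      N • (√(2 - 2 * c) ⊗ₜ[ℤ] ((baseAngle c h : ℝ) : AddCircle Real.pi) +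
        √(1 + h ^ 2) ⊗ₜ[ℤ] ((lateralAngle c h : ℝ) : AddCircle Real.pi)) := by
  have H := regularPolygon_rootsOfUnity hn
  have := H.dehnInvariant_eq hh
  rw [Complex.exp_ofReal_mul_I_re, hc] at this
  exact ⟨_, (Set.ncard_pos H.finite).2 H.nonempty |>.ne', this⟩

theorem isRationalPolytope_pyramid_iff {n : ℕ} (hn : 3 ≤ n) {h : ℝ} (hh : 0 < h) {c : ℝ}
    (hc : Real.cos (2 * Real.pi / n) = c) :
    IsRationalPolytope (pyramid n h) ↔ baseAngle c h ∈ ratPi ∧ lateralAngle c h ∈ ratPi := by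
  have := (regularPolygon_rootsOfUnity hn).isRationalPolytope_iff hh
  rwa [Complex.exp_ofReal_mul_I_re, hc] at this

theorem rational_or_dependent_of_dehnInvariant_eq_zero {n : ℕ} (hn : 3 ≤ n) {h : ℝ} (hh : 0 < h)
    {c : ℝ} (hc1 : c < 1) (hc : Real.cos (2 * Real.pi / n) = c)
    (h0 : dehnInvariant (pyramid n h) = 0) :
    (baseAngle c h ∈ ratPi ∧ lateralAngle c h ∈ ratPi) ∨
      ∃ p q : ℕ, 0 < p ∧ 0 < q ∧ p.Coprime q ∧ q * √(1 + h ^ 2) = p * √(2 - 2 * c) ∧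
        (q * baseAngle c h + p * lateralAngle c h : ℝ) ∈ ratPi := by
  obtain ⟨N, hN, hD⟩ := exists_dehnInvariant_pyramid_eq hn hh hc
  rw [hD] at h0
  exact rational_or_dependent_of_tmul_add_tmul_eq_zero hN
    (Real.sqrt_pos.2 (by linarith)) (by positivity) h0

theorem cos_two_pi_div_four : Real.cos (2 * Real.pi / (4 : ℕ)) = 0 := by
  rw [← Real.cos_pi_div_two]; congr 1; push_cast; ring

theorem cos_two_pi_div_three : Real.cos (2 * Real.pi / (3 : ℕ)) = -1 / 2 := by
  have : 2 * Real.pi / (3 : ℕ) = Real.pi - Real.pi / 3 := by push_cast; ring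
  rw [this, Real.cos_pi_sub, Real.cos_pi_div_three]; norm_num

theorem cos_two_pi_div_six : Real.cos (2 * Real.pi / (6 : ℕ)) = 1 / 2 := by
  rw [← Real.cos_pi_div_three]; congr 1; push_cast; ring

theorem dehnInvariant_pyramid_four_eq_zero_iff {h : ℝ} (hh : 0 < h) :
    dehnInvariant (pyramid 4 h) = 0 ↔ h = 1 / √2 := by
  have A := pyramidAngles_baseAngle_lateralAngle (c := 0) (by norm_num) (by norm_num) hh
  constructor
  · intro h0
    rcases rational_or_dependent_of_dehnInvariant_eq_zero (by norm_num) hh (by norm_num)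
      cos_two_pi_div_four h0 with ⟨ha, hb⟩ | ⟨p, q, hp, hq, hpq, hl, hr⟩
    · exact A.height_of_rational ha hb
    · exact absurd hr (A.not_dependent_of_zero hp hq hpq hl)
  · rintro rfl
    obtain ⟨N, -, hD⟩ := exists_dehnInvariant_pyramid_eq (by norm_num) hh cos_two_pi_div_four
    obtain ⟨ha, hb⟩ := A.rational_of_height
    rw [hD, tmul_eq_zero_of_mem_ratPi _ ha, tmul_eq_zero_of_mem_ratPi _ hb, add_zero, smul_zero]

theorem isRationalPolytope_pyramid_four_iff {h : ℝ} (hh : 0 < h) :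
    IsRationalPolytope (pyramid 4 h) ↔ h = 1 / √2 := by
  have A := pyramidAngles_baseAngle_lateralAngle (c := 0) (by norm_num) (by norm_num) hh
  rw [isRationalPolytope_pyramid_iff (by norm_num) hh cos_two_pi_div_four]
  constructor
  · rintro ⟨ha, hb⟩
    exact A.height_of_rational ha hb
  · rintro rfl
    exact A.rational_of_height

theorem dehnInvariant_pyramid_three_ne_zero {h : ℝ} (hh : 0 < h) :
    dehnInvariant (pyramid 3 h) ≠ 0 := by
  intro h0
  have A := pyramidAngles_baseAngle_lateralAngle (c := -1 / 2) (by norm_num) (by norm_num) hh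
  rcases rational_or_dependent_of_dehnInvariant_eq_zero (by norm_num) hh (by norm_num)
    cos_two_pi_div_three h0 with hab | ⟨p, q, hp, hq, hpq, hl, hr⟩
  · exact A.not_rational_of_neg_half hab
  · exact A.not_dependent_of_neg_half hp hq hpq hl hr

theorem dehnInvariant_pyramid_six_ne_zero {h : ℝ} (hh : 0 < h) :
    dehnInvariant (pyramid 6 h) ≠ 0 := by
  intro h0
  have A := pyramidAngles_baseAngle_lateralAngle (c := 1 / 2) (by norm_num) (by norm_num) hh
  rcases rational_or_dependent_of_dehnInvariant_eq_zero (by norm_num) hh (by norm_num)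
    cos_two_pi_div_six h0 with hab | ⟨p, q, hp, hq, hpq, hl, hr⟩
  · exact A.not_rational_of_half hab
  · exact A.not_dependent_of_half hp hq hpq hl hr

/-! ### Cutting the cube into six pyramids. -/

theorem pyramid_four_eq {h : ℝ} (hh : 0 < h) :
    pyramid 4 h = {x : E3 | |x 0| + |x 1| + x 2 / h ≤ 1 ∧ 0 ≤ x 2} := by
  rw [pyramid_eq]
  apply subset_antisymm
  · apply convexHull_min
    · rintro _ (rfl | ⟨z, hz, rfl⟩)
      · simp [hh.le, hh.ne']
      · have h4 : (z ^ 2 - 1) * (z ^ 2 + 1) = 0 := by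
          have : z ^ 4 = 1 := hz
          linear_combination this
        have : (z = 1 ∨ z = -1) ∨ (z = Complex.I ∨ z = -Complex.I) := by
          rcases mul_eq_zero.1 h4 with h | h
          · exact .inl (sq_eq_sq_iff_eq_or_eq_neg.1 (by rw [one_pow]; exact sub_eq_zero.1 h))
          · exact .inr (sq_eq_sq_iff_eq_or_eq_neg.1 (by rw [Complex.I_sq]; linear_combination h))
        rcases this with (rfl | rfl) | (rfl | rfl) <;> simp
    · intro x hx y hy a b ha hb hab
      refine ⟨?_, ?_⟩
      · have h0 := abs_add_le (a * x 0) (b * y 0)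
        have h1 := abs_add_le (a * x 1) (b * y 1)
        rw [abs_mul, abs_mul, abs_of_nonneg ha, abs_of_nonneg hb] at h0 h1
        have h2 := mul_le_mul_of_nonneg_left hx.1 ha
        have h3 := mul_le_mul_of_nonneg_left hy.1 hb
        simp only [PiLp.add_apply, PiLp.smul_apply, smul_eq_mul]
        have e : (a * x 2 + b * y 2) / h = a * (x 2 / h) + b * (y 2 / h) := by ring
        rw [e]
        linarith
      · simp only [PiLp.add_apply, PiLp.smul_apply, smul_eq_mul]
        exact add_nonneg (mul_nonneg ha hx.2) (mul_nonneg hb hy.2)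
  · rintro x ⟨hx1, hx2⟩
    set r := 1 - |x 0| - |x 1| - x 2 / h with hr
    have hr0 : 0 ≤ r := by linarith
    have hx3 : 0 ≤ x 2 / h := div_nonneg hx2 hh.le
    have hroot : ∀ z : ℂ, z ^ 4 = 1 →
        pt z 0 ∈ convexHull ℝ (pyramidVertices {z : ℂ | z ^ 4 = 1} h) :=
      fun z hz => subset_convexHull ℝ _ (.inr ⟨z, hz, rfl⟩)
    have hI : Complex.I ^ 4 = 1 := Complex.I_pow_four
    have := (convex_convexHull ℝ (pyramidVertices {z : ℂ | z ^ 4 = 1} h)).sum_mem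
      (t := Finset.univ)
      -- The horizontal coordinates are split into positive and negative parts, and the slack `r` is
      -- spread evenly over the four base vertices, whose sum is zero.
      (w := ![(|x 0| + x 0) / 2 + r / 4, (|x 0| - x 0) / 2 + r / 4, (|x 1| + x 1) / 2 + r / 4,
        (|x 1| - x 1) / 2 + r / 4, x 2 / h])
      (z := ![pt 1 0, pt (-1) 0, pt Complex.I 0, pt (-Complex.I) 0, pt 0 h]) ?_ ?_ ?_
    · convert this using 1
      ext i
      fin_cases i
      · simp [Fin.sum_univ_five]; ring
      · simp [Fin.sum_univ_five]; ring
      · simp [Fin.sum_univ_five]; field_simp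
    · have a1 := neg_abs_le (x 0)
      have a2 := le_abs_self (x 0)
      have a3 := neg_abs_le (x 1)
      have a4 := le_abs_self (x 1)
      intro i _
      fin_cases i <;> simp <;> linarith
    · simp [Fin.sum_univ_five]; rw [hr]; ring
    · intro i _
      fin_cases i
      · exact hroot 1 (by norm_num)
      · exact hroot (-1) (by norm_num)
      · exact hroot _ hI
      · exact hroot (-Complex.I) (by rw [neg_pow, hI]; norm_num)
      · exact subset_convexHull ℝ _ (.inl rfl)

/-- The pyramid with apex at the origin over the facet `ε * x i = h` of the cube `[-h, h]³`. -/
def cubePyramid (h : ℝ) (i : Fin 3) (ε : ℝ) : Set E3 :=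
  {x | (∀ j, |x j| ≤ ε * x i) ∧ ε * x i ≤ h}

theorem exists_isometry_image_pyramid_four :
    ∃ T : E3 ≃ᵢ E3, T '' pyramid 4 (1 / √2) = cubePyramid (1 / √2) 2 1 := by
  set h : ℝ := 1 / √2 with hdef
  have hh : 0 < h := by positivity
  have hh2 : h ^ 2 = 1 / 2 := by
    rw [hdef, div_pow, Real.sq_sqrt (by norm_num)]; norm_num
  -- Since `2h² = 1`, this is an isometric involution. It aligns the sides of the square base with
  -- the axes and moves the apex to the origin; the base inequality becomes one on `|x 0 + x 1| + |x
  -- 0 - x 1| = 2 max (|x 0|, |x 1|)`.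
  let f : E3 → E3 := fun x => !₂[h * (x 0 + x 1), h * (x 0 - x 1), h - x 2]
  have hf0 : ∀ x, f x 0 = h * (x 0 + x 1) := fun x => rfl
  have hf1 : ∀ x, f x 1 = h * (x 0 - x 1) := fun x => rfl
  have hf2 : ∀ x, f x 2 = h - x 2 := fun x => rfl
  have hff : ∀ x, f (f x) = x := by
    intro x
    ext i
    fin_cases i
    · change f (f x) 0 = x 0
      rw [hf0, hf0, hf1]; linear_combination 2 * x 0 * hh2
    · change f (f x) 1 = x 1
      rw [hf1, hf0, hf1]; linear_combination 2 * x 1 * hh2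
    · change f (f x) 2 = x 2
      rw [hf2, hf2]; ring
  have hiso : Isometry f := by
    refine Isometry.of_dist_eq fun x y => ?_
    rw [EuclideanSpace.dist_eq, EuclideanSpace.dist_eq]
    congr 1
    simp only [Fin.sum_univ_three, Real.dist_eq, sq_abs, hf0, hf1, hf2]
    linear_combination 2 * ((x 0 - y 0) ^ 2 + (x 1 - y 1) ^ 2) * hh2
  let T := IsometryEquiv.mk' f f hff hiso
  refine ⟨T, ?_⟩
  have himg : T '' pyramid 4 h = f ⁻¹' pyramid 4 h :=
    congrFun (Set.image_eq_preimage_of_inverse hff hff) _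
  rw [himg, pyramid_four_eq hh]
  ext x
  have h1 : |f x 0| = h * |x 0 + x 1| := by rw [hf0, abs_mul, abs_of_pos hh]
  have h2 : |f x 1| = h * |x 0 - x 1| := by rw [hf1, abs_mul, abs_of_pos hh]
  have h3 : f x 2 / h = 1 - 2 * h * x 2 := by
    rw [hf2, div_eq_iff hh.ne']; linear_combination 2 * x 2 * hh2
  have key : h * |x 0 + x 1| + h * |x 0 - x 1| + (1 - 2 * h * x 2) ≤ 1 ↔
      |x 0 + x 1| + |x 0 - x 1| ≤ 2 * x 2 := by
    constructor
    · intro H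
      have : h * (|x 0 + x 1| + |x 0 - x 1|) ≤ h * (2 * x 2) := by linarith
      exact le_of_mul_le_mul_left this hh
    · intro H
      have := mul_le_mul_of_nonneg_left H hh.le
      linarith
  change (|f x 0| + |f x 1| + f x 2 / h ≤ 1 ∧ 0 ≤ f x 2) ↔ (∀ j, |x j| ≤ 1 * x 2) ∧ 1 * x 2 ≤ h
  rw [h1, h2, h3, key, hf2, one_mul, sub_nonneg]
  refine and_congr_left fun _ => ⟨fun H j => ?_, fun H => ?_⟩
  · have a1 := le_abs_self (x 0 + x 1)
    have a2 := neg_abs_le (x 0 + x 1)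
    have a3 := le_abs_self (x 0 - x 1)
    have a4 := neg_abs_le (x 0 - x 1)
    rw [one_mul, abs_le]
    fin_cases j
    · change -x 2 ≤ x 0 ∧ x 0 ≤ x 2; constructor <;> linarith
    · change -x 2 ≤ x 1 ∧ x 1 ≤ x 2; constructor <;> linarith
    · change -x 2 ≤ x 2 ∧ x 2 ≤ x 2; constructor <;> linarith
  · simp only [one_mul] at H
    have b0 := abs_le.1 (H 0)
    have b1 := abs_le.1 (H 1)
    rcases abs_cases (x 0 + x 1) with ⟨e, -⟩ | ⟨e, -⟩ <;>
      rcases abs_cases (x 0 - x 1) with ⟨e', -⟩ | ⟨e', -⟩ <;> rw [e, e'] <;> linarith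

theorem exists_isometry_image_cubePyramid (h : ℝ) (i : Fin 3) {ε : ℝ} (hε : ε ^ 2 = 1) :
    ∃ S : E3 ≃ᵢ E3, S '' cubePyramid h 2 1 = cubePyramid h i ε := by
  let f : E3 → E3 := fun x => WithLp.toLp 2 fun j => ε * x (Equiv.swap i 2 j)
  have hf : ∀ x j, f x j = ε * x (Equiv.swap i 2 j) := fun x j => rfl
  have hff : ∀ x, f (f x) = x := by
    intro x
    ext j
    rw [hf, hf, Equiv.swap_apply_self]; linear_combination x j * hε
  have hiso : Isometry f := by
    refine Isometry.of_dist_eq fun x y => ?_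
    rw [EuclideanSpace.dist_eq, EuclideanSpace.dist_eq]
    congr 1
    rw [← Equiv.sum_comp (Equiv.swap i 2)]
    refine Finset.sum_congr rfl fun j _ => ?_
    rw [hf, hf, Equiv.swap_apply_self, Real.dist_eq, Real.dist_eq, sq_abs, sq_abs]
    linear_combination (x j - y j) ^ 2 * hε
  have habs : |ε| = 1 := by
    rcases sq_eq_sq_iff_eq_or_eq_neg.1 (hε.trans (one_pow 2).symm) with rfl | rfl <;> simp
  refine ⟨IsometryEquiv.mk' f f hff hiso, ?_⟩
  have himg : IsometryEquiv.mk' f f hff hiso '' cubePyramid h 2 1 = f ⁻¹' cubePyramid h 2 1 :=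
    congrFun (Set.image_eq_preimage_of_inverse hff hff) _
  rw [himg]
  ext x
  change (∀ j, |f x j| ≤ 1 * f x 2) ∧ 1 * f x 2 ≤ h ↔ (∀ j, |x j| ≤ ε * x i) ∧ ε * x i ≤ h
  simp only [hf, Equiv.swap_apply_right, one_mul, abs_mul, habs]
  refine and_congr_left fun _ => ⟨fun H j => ?_, fun H j => H _⟩
  simpa using H (Equiv.swap i 2 j)

/-- On both pyramids the functional `ε * x i` equals the maximum of the absolute coordinates, and so
does `δ * x j`. Their intersection thus lies in a proper subspace, which has empty interior. -/
theorem disjoint_interior_cubePyramid {h : ℝ} {i j : Fin 3} {ε δ : ℝ} (hε : ε ^ 2 = 1)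
    (hδ : δ ^ 2 = 1) (hne : i = j → ε ≠ δ) :
    Disjoint (interior (cubePyramid h i ε)) (interior (cubePyramid h j δ)) := by
  rw [Set.disjoint_iff_inter_eq_empty, ← interior_inter]
  by_contra hint
  let l : E3 →ₗ[ℝ] ℝ := ε • (EuclideanSpace.proj i : E3 →L[ℝ] ℝ).toLinearMap -
    δ • (EuclideanSpace.proj j : E3 →L[ℝ] ℝ).toLinearMap
  have hl : ∀ x : E3, l x = ε * x i - δ * x j := fun x => rfl
  have hle : ∀ {ε : ℝ}, ε ^ 2 = 1 → ∀ t : ℝ, ε * t ≤ |t| := by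
    intro ε hε t
    rcases sq_eq_sq_iff_eq_or_eq_neg.1 (hε.trans (one_pow 2).symm) with rfl | rfl
    · rw [one_mul]; exact le_abs_self t
    · rw [neg_one_mul]; exact neg_le_abs t
  have hsub : cubePyramid h i ε ∩ cubePyramid h j δ ⊆ (LinearMap.ker l : Set E3) := by
    rintro x ⟨hx, hx'⟩
    rw [SetLike.mem_coe, LinearMap.mem_ker, hl]
    have h1 := (hle hε (x i)).trans (hx'.1 i)
    have h2 := (hle hδ (x j)).trans (hx.1 j)
    linarith
  have htop := (LinearMap.ker l).eq_top_of_nonempty_interior'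
    ((Set.nonempty_iff_ne_empty.2 hint).mono (interior_mono hsub))
  have h1 : l (EuclideanSpace.single i 1) = 0 := LinearMap.mem_ker.1 (htop ▸ Submodule.mem_top)
  rw [hl] at h1
  by_cases hij : i = j
  · subst hij
    apply hne rfl
    simp only [PiLp.single_apply, if_true, mul_one] at h1
    linarith
  · simp only [PiLp.single_apply, if_true, if_neg (Ne.symm hij), mul_one, mul_zero,
      sub_zero] at h1
    rw [h1] at hε
    norm_num at hε

theorem mem_cube_iff_exists_mem_cubePyramid {h : ℝ} {x : E3} :
    (∀ i, |x i| ≤ h) ↔ ∃ (i : Fin 3) (b : Fin 2), x ∈ cubePyramid h i ((-1) ^ (b : ℕ)) := by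
  constructor
  · intro hx
    obtain ⟨i, hi⟩ := Finite.exists_max fun j => |x j|
    rcases abs_cases (x i) with ⟨e, -⟩ | ⟨e, -⟩
    · have he : (-1 : ℝ) ^ ((0 : Fin 2) : ℕ) * x i = |x i| := by simp [e]
      exact ⟨i, 0, fun j => by rw [he]; exact hi j, by rw [he]; exact hx i⟩
    · have he : (-1 : ℝ) ^ ((1 : Fin 2) : ℕ) * x i = |x i| := by simp [e]
      exact ⟨i, 1, fun j => by rw [he]; exact hi j, by rw [he]; exact hx i⟩
  · rintro ⟨i, b, h1, h2⟩ j
    exact (h1 j).trans h2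

theorem exists_cube_isCutIntoSix : ∃ C : Set E3, IsCube C ∧ IsCutIntoSix C (pyramid 4 (1 / √2)) := by
  have hsq : ∀ b : Fin 2, ((-1 : ℝ) ^ (b : ℕ)) ^ 2 = 1 := fun b => by
    rw [← pow_mul, mul_comm, pow_mul]; norm_num
  obtain ⟨T, hT⟩ := exists_isometry_image_pyramid_four
  choose S hS using fun (i : Fin 3) (b : Fin 2) =>
    exists_isometry_image_cubePyramid (1 / √2) i (hsq b)
  let e : Fin 6 ≃ Fin 3 × Fin 2 := (finProdFinEquiv (m := 3) (n := 2)).symm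
  have himg : ∀ k, (T.trans (S (e k).1 (e k).2)) '' pyramid 4 (1 / √2) =
      cubePyramid (1 / √2) (e k).1 ((-1) ^ ((e k).2 : ℕ)) := by
    intro k
    rw [← hS, ← hT, ← Set.image_comp]
    rfl
  refine ⟨{x | ∀ i, |x i| ≤ 1 / √2}, ⟨1 / √2, by positivity, IsometryEquiv.refl E3, (Set.image_id _).symm⟩,
    fun k => T.trans (S (e k).1 (e k).2), ?_, ?_⟩
  · ext x
    simp only [himg, Set.mem_iUnion]
    rw [e.surjective.exists (p := fun k => x ∈ cubePyramid (1 / √2) k.1 ((-1) ^ (k.2 : ℕ))) |>.symm,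
      Prod.exists]
    exact mem_cube_iff_exists_mem_cubePyramid
  · intro k k' hkk'
    simp only [himg]
    refine disjoint_interior_cubePyramid (hsq _) (hsq _) fun hi hb => hkk' ?_
    apply e.injective
    refine Prod.ext hi ?_
    generalize (e k).2 = b at hb ⊢
    generalize (e k').2 = b' at hb ⊢
    fin_cases b <;> fin_cases b' <;> first | rfl | norm_num at hb

theorem theorem1 :
    (∀ h : ℝ, 0 < h → (dehnInvariant (pyramid 4 h) = 0 ↔ h = 1 / Real.sqrt 2)) ∧
    (∀ h : ℝ, 0 < h → (IsRationalPolytope (pyramid 4 h) ↔ h = 1 / Real.sqrt 2)) ∧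
    (∃ C : Set E3, IsCube C ∧ IsCutIntoSix C (pyramid 4 (1 / Real.sqrt 2))) ∧
    (∀ h : ℝ, 0 < h → dehnInvariant (pyramid 3 h) ≠ 0) ∧
    (∀ h : ℝ, 0 < h → dehnInvariant (pyramid 6 h) ≠ 0) :=
  ⟨fun _ hh => dehnInvariant_pyramid_four_eq_zero_iff hh,
    fun _ hh => isRationalPolytope_pyramid_four_iff hh, exists_cube_isCutIntoSix,
    fun _ hh => dehnInvariant_pyramid_three_ne_zero hh,
    fun _ hh => dehnInvariant_pyramid_six_ne_zero hh⟩
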